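/- **Setting.** Let $n,q,T,N,H\ge 1$ be integers, let $A\in\mathbb R^{n\times n}$ and $B=[B_1\ \cdots\ B_q]$ with $B_i\in\mathbb R^{n\times m_i}$, $m=\sum_{i=1}^q m_i$. Write $\|\cdot\|$ for the spectral norm and $\sigma_1(M)\ge\sigma_2(M)\ge\cdots$ for the singular values of a matrix $M$. For each round $t\in\{1,\dots,T\}$ let $Q^{(t)}\in\mathbb R^{n\times n}$ be symmetric positive semidefinite with $\sigma_n(Q^{(t)})\ge 1$, $Q_f^{(t)}\in\mathbb R^{n\times n}$ symmetric positive definite, and $R^{(t)}\in\mathbb R^{m\times m}$ symmetric positive definite with $\sigma_m(R^{(t)})\ge 1$. For $\mathcal S\subseteq\{1,\dots,q\}$ let $B_{\mathcal S}$ consist of the blocks $B_i$ with $i\in\mathcal S$, let $R^{(t)}_{\mathcal S}$ be the corresponding principal submatrix of $R^{(t)}$, and let $m_{\mathcal S}=\sum_{i\in\mathcal S}m_i$. Let $1\le\ell\le n-1$ and $\nu>0$ be such that $$\sigma_n\big([B_{\mathcal S}\ \ AB_{\mathcal S}\ \cdots\ A^{\ell-1}B_{\mathcal S}]\big)\ge\nu\quad\text{for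 every }\mathcal S\subseteq\{1,\dots,q\}\text{ with }|\mathcal S|=H.$$ In round $t$ with selected set $\mathcal S$ the system is $x_0=0$, $x_{k+1}=Ax_k+B_{\mathcal S}u_k+w_k$ for $0\le k<N$, where $w_0,\dots,w_{N-1}$ are independent zero-mean Gaussian vectors with covariance $W$. The cost is $\sum_{k=0}^{N-1}(x_k^\top Q^{(t)}x_k+u_k^\top R^{(t)}_{\mathcal S}u_k)+x_N^\top Q^{(t)}_fx_N$. Let $P^{(t)}_{N,\mathcal S}=Q_f^{(t)}$ and, for $0\le k<N$ (writing $P_{k}$, $K_k$ for $P^{(t)}_{k,\mathcal S}$, $K^{(t)}_{k,\mathcal S}$), $$P_{k}=Q^{(t)}+A^\top P_{k+1}A-A^\top P_{k+1}B_{\mathcal S}(B_{\mathcal S}^\top P_{k+1}B_{\mathcal S}+R^{(t)}_{\mathcal S})^{-1}B_{\mathcal S}^\top P_{k+1}A,$$ $$K_{k}=-(B_{\mathcal S}^\top P_{k+1}B_{\mathcal S}+R^{(t)}_{\mathcal S})^{-1}B_{\mathcal S}^\top P_{k+1}A.$$ Let $\hat P^{(t)}_{k,\mathcal S},\hat K^{(t)}_{k,\mathcal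 S}$ be given by the same formulas, with the same terminal value $Q_f^{(t)}$, for estimates $\hat A,\hat B_{\mathcal S}$ in place of $A,B_{\mathcal S}$. Put $\sigma_Q=\max_t\max\{\sigma_1(Q^{(t)}),\sigma_1(Q_f^{(t)})\}$, $\sigma_R=\max_t\sigma_1(R^{(t)})$, $$\Gamma_{\mathcal S}=\max_{1\le t\le T}\ \max_{1\le k\le N}\max\{\|A\|,\|B\|,\|P^{(t)}_{k,\mathcal S}\|,\|K^{(t)}_{k-1,\mathcal S}\|\},\qquad \tilde\Gamma_{\mathcal S}=1+\Gamma_{\mathcal S},$$ $$\mu_{\mathcal S}=32\,\ell^{5/2}\beta^{2(\ell-1)}(1+\nu^{-1})\tilde\Gamma_{\mathcal S}^3\max\{\sigma_Q,\sigma_R\},\qquad \beta=\max\{1,\varepsilon+\|A\|\}.$$ **Statement.** Let $\mathcal S\subseteq\{1,\dots,q\}$ with $|\mathcal S|=H$, let $t\in\{1,\dots,T\}$, and let $\varepsilon>0$, $\|A-\hat A\|\le\varepsilon$, $\|B-\hat B\|\le\varepsilon$. Let $\zeta_{\mathcal S}\ge 1$ and $0<\eta_{\mathcal S}<1$ be such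 that $$\big\|(A+B_{\mathcal S}K^{(t)}_{k_2-1,\mathcal S})\cdots(A+B_{\mathcal S}K^{(t)}_{k_1,\mathcal S})\big\|\le\zeta_{\mathcal S}\,\eta_{\mathcal S}^{k_2-k_1}\quad\text{for all }0\le k_1\le k_2\le N$$ (the empty product is $I$). Suppose that $$\varepsilon\le\frac{1-\eta_{\mathcal S}}{6\|B_{\mathcal S}\|\zeta_{\mathcal S}}\,\tilde\Gamma_{\mathcal S}^{-3}\,(20\tilde\Gamma_{\mathcal S}^9\sigma_R)^{1-\ell}\,\mu_{\mathcal S}^{-1}.$$ Let $J_t(\mathcal S)$ be the minimum of the expected cost over causal control policies ($u_k$ a measurable function of $x_0,\dots,x_k$); this minimum is attained and equals $\sum_{k=0}^{N-1}\operatorname{Tr}(P^{(t)}_{k+1,\mathcal S}W)$. Let $\hat J_t(\mathcal S)$ be the expected cost, which is finite, of the certainty-equivalent controller $u_k=\hat K^{(t)}_{k,\mathcal S}x_k$ on the true system $(A,B_{\mathcal S})$. Then $$\hat J_t(\mathcal S)-J_t(\mathcal S)\le\frac{4\min\{n,m_{\mathcal S}\}N\zeta_{\mathcal S}^2}{1-\eta_{\mathcal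 S}^2}\,\sigma_1(W)\,\big(\sigma_R+\Gamma_{\mathcal S}^3\big)\Big(3\tilde\Gamma_{\mathcal S}^3\,(20\tilde\Gamma_{\mathcal S}^9\sigma_R)^{\ell-1}\mu_{\mathcal S}\Big)^2\varepsilon^2 .$$ -/

import Mathlib

open MeasureTheory ProbabilityTheory
open scoped Matrix Matrix.Norms.L2Operator

noncomputable section

/-! Throughout, `‖M‖` for a real matrix `M` is the `ℓ²` operator norm, i.e. the largest singular
value `σ₁(M)`. -/

/-- The `j`-th largest singular value `σ_j(M)` of a real matrix, counted from `j = 1` and with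
multiplicity; it is `0` when `j` exceeds the rank. -/
def matrixSingularValue {ι κ : Type*} [Fintype ι] [Fintype κ] [DecidableEq κ]
    (j : ℕ) (M : Matrix ι κ ℝ) : ℝ :=
  (Matrix.toEuclideanLin M).singularValues (j - 1)

section LQR

variable {n : ℕ} {κ : Type*} [Fintype κ] [DecidableEq κ]

/-- The feedback gain `-(Bᵀ X B + R)⁻¹ Bᵀ X A`. -/
def lqrGain (A : Matrix (Fin n) (Fin n) ℝ) (B : Matrix (Fin n) κ ℝ) (R : Matrix κ κ ℝ)
    (X : Matrix (Fin n) (Fin n) ℝ) : Matrix κ (Fin n) ℝ :=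
  -((Bᵀ * X * B + R)⁻¹ * Bᵀ * X * A)

/-- One backward step of the Riccati recursion,
`X ↦ Q + Aᵀ X A - Aᵀ X B (Bᵀ X B + R)⁻¹ Bᵀ X A`. -/
def riccatiStep (A : Matrix (Fin n) (Fin n) ℝ) (B : Matrix (Fin n) κ ℝ)
    (Q : Matrix (Fin n) (Fin n) ℝ) (R : Matrix κ κ ℝ) (X : Matrix (Fin n) (Fin n) ℝ) :
    Matrix (Fin n) (Fin n) ℝ :=
  Q + Aᵀ * X * A - Aᵀ * X * B * (Bᵀ * X * B + R)⁻¹ * Bᵀ * X * A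

/-- The matrix `P_k` of the Riccati recursion over the horizon `N`, for `k ≤ N`: `P_N = Qf`, and
`P_k` is obtained from `P_{k+1}` by one backward step. -/
def riccatiP (A : Matrix (Fin n) (Fin n) ℝ) (B : Matrix (Fin n) κ ℝ)
    (Q : Matrix (Fin n) (Fin n) ℝ) (R : Matrix κ κ ℝ) (Qf : Matrix (Fin n) (Fin n) ℝ)
    (N k : ℕ) : Matrix (Fin n) (Fin n) ℝ :=
  (riccatiStep A B Q R)^[N - k] Qf

/-- The gain `K_k = -(Bᵀ P_{k+1} B + R)⁻¹ Bᵀ P_{k+1} A`, for `k < N`. -/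
def riccatiK (A : Matrix (Fin n) (Fin n) ℝ) (B : Matrix (Fin n) κ ℝ)
    (Q : Matrix (Fin n) (Fin n) ℝ) (R : Matrix κ κ ℝ) (Qf : Matrix (Fin n) (Fin n) ℝ)
    (N k : ℕ) : Matrix κ (Fin n) ℝ :=
  lqrGain A B R (riccatiP A B Q R Qf N (k + 1))

/-- The transition matrix `M_{k₂-1} M_{k₂-2} ⋯ M_{k₁}`, equal to `I` if `k₂ ≤ k₁`. -/
def transitionMatrix (M : ℕ → Matrix (Fin n) (Fin n) ℝ) (k₁ : ℕ) : ℕ → Matrix (Fin n) (Fin n) ℝ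
  | 0 => 1
  | k₂ + 1 => if k₂ + 1 ≤ k₁ then 1 else M k₂ * transitionMatrix M k₁ k₂

/-- The matrix `[B, A B, …, A^{l-1} B]`, with columns indexed by pairs (power, column of `B`). -/
def controllabilityMatrix (A : Matrix (Fin n) (Fin n) ℝ) (B : Matrix (Fin n) κ ℝ) (l : ℕ) :
    Matrix (Fin n) (Fin l × κ) ℝ :=
  Matrix.of fun i c => (A ^ (c.1 : ℕ) * B) i c.2

/-- The quadratic cost `∑_{k<N} (x_kᵀ Q x_k + u_kᵀ R u_k) + x_Nᵀ Qf x_N` of a trajectory. -/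
def lqrCost (Q : Matrix (Fin n) (Fin n) ℝ) (R : Matrix κ κ ℝ) (Qf : Matrix (Fin n) (Fin n) ℝ)
    (N : ℕ) (x : ℕ → Fin n → ℝ) (u : ℕ → κ → ℝ) : ℝ :=
  (∑ k ∈ Finset.range N, (x k ⬝ᵥ (Q *ᵥ x k) + u k ⬝ᵥ (R *ᵥ u k))) + x N ⬝ᵥ (Qf *ᵥ x N)

variable {Ω : Type*}

/-- The state `x_{k+1} = A x_k + B u_k + w_k`, `x_0 = 0`, driven by the input process `u`. -/
def stateProcess (A : Matrix (Fin n) (Fin n) ℝ) (B : Matrix (Fin n) κ ℝ)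
    (w : ℕ → Ω → Fin n → ℝ) (u : ℕ → Ω → κ → ℝ) : ℕ → Ω → Fin n → ℝ
  | 0 => fun _ => 0
  | k + 1 => fun ω => A *ᵥ stateProcess A B w u k ω + B *ᵥ u k ω + w k ω

/-- The state under the linear feedback `u_k = K_k x_k`:
`x_{k+1} = A x_k + B K_k x_k + w_k`, `x_0 = 0`. -/
def feedbackState (A : Matrix (Fin n) (Fin n) ℝ) (B : Matrix (Fin n) κ ℝ)
    (K : ℕ → Matrix κ (Fin n) ℝ) (w : ℕ → Ω → Fin n → ℝ) : ℕ → Ω → Fin n → ℝ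
  | 0 => fun _ => 0
  | k + 1 => fun ω => A *ᵥ feedbackState A B K w k ω + B *ᵥ (K k *ᵥ feedbackState A B K w k ω)
      + w k ω

/-- The (random) cost of the linear feedback `u_k = K_k x_k` on the system `(A, B)`. -/
def feedbackCost (A : Matrix (Fin n) (Fin n) ℝ) (B : Matrix (Fin n) κ ℝ)
    (Q : Matrix (Fin n) (Fin n) ℝ) (R : Matrix κ κ ℝ) (Qf : Matrix (Fin n) (Fin n) ℝ) (N : ℕ)
    (K : ℕ → Matrix κ (Fin n) ℝ) (w : ℕ → Ω → Fin n → ℝ) (ω : Ω) : ℝ :=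
  lqrCost Q R Qf N (fun k => feedbackState A B K w k ω)
    (fun k => K k *ᵥ feedbackState A B K w k ω)

/-- The expected costs that causal control policies attain over the horizon `N`: each input `u_k`,
`k < N`, is a measurable function of the states `x_0, …, x_k`. A policy whose cost is not
integrable (its expected cost would be `+∞`) contributes no value. -/
def attainableCosts [MeasurableSpace Ω] (Pr : Measure Ω)
    (A : Matrix (Fin n) (Fin n) ℝ) (B : Matrix (Fin n) κ ℝ)
    (Q : Matrix (Fin n) (Fin n) ℝ) (R : Matrix κ κ ℝ) (Qf : Matrix (Fin n) (Fin n) ℝ) (N : ℕ)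
    (w : ℕ → Ω → Fin n → ℝ) : Set ℝ :=
  {c | ∃ u : ℕ → Ω → κ → ℝ,
    (∀ k < N, Measurable[⨆ j : Fin (k + 1),
      MeasurableSpace.comap (stateProcess A B w u j) inferInstance] (u k)) ∧
    Integrable (fun ω => lqrCost Q R Qf N (fun k => stateProcess A B w u k ω)
      (fun k => u k ω)) Pr ∧
    c = ∫ ω, lqrCost Q R Qf N (fun k => stateProcess A B w u k ω) (fun k => u k ω) ∂Pr}

/-- `w_0, …, w_{N-1}` is zero-mean white Gaussian noise with covariance `W`: the `w_k` are
independent Gaussian vectors with `E[w_k] = 0` and `E[w_k w_kᵀ] = W`. -/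
structure IsWhiteGaussianNoise [MeasurableSpace Ω] (Pr : Measure Ω) (N : ℕ)
    (W : Matrix (Fin n) (Fin n) ℝ) (w : ℕ → Ω → Fin n → ℝ) : Prop where
  measurable : ∀ k < N, Measurable (w k)
  gaussian : ∀ k < N, HasGaussianLaw (w k) Pr
  mean_zero : ∀ k < N, ∀ i, ∫ ω, w k ω i ∂Pr = 0
  covariance : ∀ k < N, ∀ i j, ∫ ω, w k ω i * w k ω j ∂Pr = W i j
  indep : iIndepFun (fun k : Fin N => w k) Pr

end LQR

section Actuators

variable {n q T : ℕ} {m : Fin q → ℕ}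

/-- Input coordinates of all actuators: actuator `i` has `m i` of them. -/
abbrev AllInputs (m : Fin q → ℕ) : Type := (i : Fin q) × Fin (m i)

/-- Input coordinates of the actuators in `S`. -/
abbrev SelInputs (m : Fin q → ℕ) (S : Finset (Fin q)) : Type := (i : {i // i ∈ S}) × Fin (m i)

/-- The inclusion of the input coordinates of the actuators in `S` into all of them. -/
def selIncl (S : Finset (Fin q)) (a : SelInputs m S) : AllInputs m := ⟨a.1, a.2⟩

/-- `B_S`: the columns of `B` that belong to the actuators in `S`. -/
def selB (B : Matrix (Fin n) (AllInputs m) ℝ) (S : Finset (Fin q)) :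
    Matrix (Fin n) (SelInputs m S) ℝ :=
  B.submatrix id (selIncl S)

/-- `R_S`: the rows and columns of `R` that belong to the actuators in `S`. -/
def selR (R : Matrix (AllInputs m) (AllInputs m) ℝ) (S : Finset (Fin q)) :
    Matrix (SelInputs m S) (SelInputs m S) ℝ :=
  R.submatrix (selIncl S) (selIncl S)

/-- `σ_Q = max {max_t σ₁(Q⁽ᵗ⁾), max_t σ₁(Qf⁽ᵗ⁾)}`. -/
def sigmaQ (Q Qf : Fin T → Matrix (Fin n) (Fin n) ℝ) : ℝ := max (⨆ t, ‖Q t‖) (⨆ t, ‖Qf t‖)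

/-- `σ_R = max_t σ₁(R⁽ᵗ⁾)`. -/
def sigmaR (R : Fin T → Matrix (AllInputs m) (AllInputs m) ℝ) : ℝ := ⨆ t, ‖R t‖

/-- `Γ_S = max_t max_{1 ≤ k ≤ N} max {‖A‖, ‖B‖, ‖P_{k,S}⁽ᵗ⁾‖, ‖K_{k-1,S}⁽ᵗ⁾‖}`
(the index `k` below runs over `0, …, N - 1` and stands for `k - 1`). -/
def gammaS (A : Matrix (Fin n) (Fin n) ℝ) (B : Matrix (Fin n) (AllInputs m) ℝ)
    (Q : Fin T → Matrix (Fin n) (Fin n) ℝ) (R : Fin T → Matrix (AllInputs m) (AllInputs m) ℝ)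
    (Qf : Fin T → Matrix (Fin n) (Fin n) ℝ) (N : ℕ) (S : Finset (Fin q)) : ℝ :=
  ⨆ t : Fin T, ⨆ k : Fin N,
    max (max ‖A‖ ‖B‖)
      (max ‖riccatiP A (selB B S) (Q t) (selR (R t) S) (Qf t) N (k + 1)‖
        ‖riccatiK A (selB B S) (Q t) (selR (R t) S) (Qf t) N k‖)

/-- `μ_S = 32 l^{5/2} β^{2(l-1)} (1 + ν⁻¹) (1 + Γ_S)³ max {σ_Q, σ_R}` with
`β = max {1, ε + ‖A‖}`. -/
def muS (A : Matrix (Fin n) (Fin n) ℝ) (B : Matrix (Fin n) (AllInputs m) ℝ)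
    (Q : Fin T → Matrix (Fin n) (Fin n) ℝ) (R : Fin T → Matrix (AllInputs m) (AllInputs m) ℝ)
    (Qf : Fin T → Matrix (Fin n) (Fin n) ℝ) (N : ℕ) (S : Finset (Fin q))
    (l : ℕ) (ν ε : ℝ) : ℝ :=
  32 * (l : ℝ) ^ (5 / 2 : ℝ) * (max 1 (ε + ‖A‖)) ^ (2 * (l - 1)) * (1 + ν⁻¹)
    * (1 + gammaS A B Q R Qf N S) ^ 3 * max (sigmaQ Q Qf) (sigmaR R)

/-- `(20 (1 + Γ_S)⁹ σ_R)^{l-1} μ_S`. -/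
def riccatiErrorFactor (A : Matrix (Fin n) (Fin n) ℝ) (B : Matrix (Fin n) (AllInputs m) ℝ)
    (Q : Fin T → Matrix (Fin n) (Fin n) ℝ) (R : Fin T → Matrix (AllInputs m) (AllInputs m) ℝ)
    (Qf : Fin T → Matrix (Fin n) (Fin n) ℝ) (N : ℕ) (S : Finset (Fin q))
    (l : ℕ) (ν ε : ℝ) : ℝ :=
  (20 * (1 + gammaS A B Q R Qf N S) ^ 9 * sigmaR R) ^ (l - 1) * muS A B Q R Qf N S l ν ε

end Actuators

end

set_option linter.unusedSectionVars false

/-! ### Quadratic forms and the spectral norm -/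

section Forms

variable {ι κ : Type*} [Fintype ι] [Fintype κ] [DecidableEq ι] [DecidableEq κ]

/-! Completing the square along the Riccati recursion writes the expected cost of any causal policy
as `∑ Tr (P_{k+1} W)` plus the expected values of the forms `B_Sᵀ P_{k+1} B_S + R_S` at `u_k - K_k
x_k` (`IsCausal.integral_lqrCost`). The extra terms are nonnegative and vanish for the Riccati
feedback, so the first sum is the optimal cost. For the certainty-equivalent controller the excess
is the same form at `(K'_k - K_k) x_k`, where `K'` denotes the estimated gain. Three bounds remain,
besides `σ_R + Γ³` for the form.

Gains: `Q ≥ I` and `R ≥ I` make the value function of one system a Lyapunov function when its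
optimal feedback runs on the nearby system. Hence `P' ≤ ρ P` with `ρ = 1 + O(ε)`, and exchanging the
systems bounds `P' - P` by `6 (1 + Γ)³ ε` (`norm_riccatiP_sub_le`). No controllability enters here.
Writing `D` for `riccatiErrorFactor`, this error is at most `D ε`, and `norm_lqrGain_sub_le` turns
it into `‖K' - K‖ ≤ 3 (1 + Γ)³ D ε`.

Stability: the closed loop changes by at most `‖B_S‖ ‖K' - K‖` per step, which the smallness of `ε`
makes so small that the decay rate rises from `η` to at most `(1 + η) / 2`
(`norm_transitionMatrix_le_of_perturbation`).

State: a geometric series bounds the second moment of `x_k` in every direction. Summing over the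
coordinates of `x_k` or over those of `(K' - K) x_k` produces the factor `min n m_S`
(`integral_mulVec_dotProduct_self_le`).

Controllability serves only to bound `‖B_S‖` below in terms of `ν`. The bound assumed on `ε` has
`‖B_S‖` in its denominator, and `ν` inside `μ_S` compensates for a small `‖B_S‖`
(`smallness_consequences`). -/

lemma dotProduct_self_eq_norm_sq (x : ι → ℝ) : x ⬝ᵥ x = ‖WithLp.toLp 2 x‖ ^ 2 := by
  rw [EuclideanSpace.real_norm_sq_eq]
  simp [dotProduct, sq]

lemma dotProduct_self_nonneg_real (x : ι → ℝ) : 0 ≤ x ⬝ᵥ x := by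
  rw [dotProduct_self_eq_norm_sq]; positivity

lemma mulVec_dotProduct_self_le (M : Matrix ι κ ℝ) (x : κ → ℝ) :
    (M *ᵥ x) ⬝ᵥ (M *ᵥ x) ≤ ‖M‖ ^ 2 * (x ⬝ᵥ x) := by
  rw [dotProduct_self_eq_norm_sq, dotProduct_self_eq_norm_sq, ← mul_pow]
  exact pow_le_pow_left₀ (norm_nonneg _) (M.l2_opNorm_mulVec (WithLp.toLp 2 x)) 2

lemma mulVec_dotProduct_self_le_of_norm_le {M : Matrix ι κ ℝ} {c : ℝ} (h : ‖M‖ ≤ c)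
    (x : κ → ℝ) : (M *ᵥ x) ⬝ᵥ (M *ᵥ x) ≤ c ^ 2 * (x ⬝ᵥ x) :=
  (mulVec_dotProduct_self_le M x).trans <|
    mul_le_mul_of_nonneg_right (pow_le_pow_left₀ (norm_nonneg _) h 2) (dotProduct_self_nonneg_real x)

lemma norm_le_of_mulVec_dotProduct_self_le {M : Matrix ι κ ℝ} {c : ℝ} (hc : 0 ≤ c)
    (h : ∀ x, (M *ᵥ x) ⬝ᵥ (M *ᵥ x) ≤ c ^ 2 * (x ⬝ᵥ x)) : ‖M‖ ≤ c := by
  rw [Matrix.l2_opNorm_def]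
  refine ContinuousLinearMap.opNorm_le_bound _ hc fun x => ?_
  have := h (WithLp.ofLp x)
  rw [dotProduct_self_eq_norm_sq, dotProduct_self_eq_norm_sq, ← mul_pow] at this
  exact le_of_sq_le_sq this (by positivity)

lemma sq_dotProduct_le (x y : ι → ℝ) : (x ⬝ᵥ y) ^ 2 ≤ (x ⬝ᵥ x) * (y ⬝ᵥ y) := by
  simpa [dotProduct, sq] using Finset.sum_mul_sq_le_sq_mul_sq Finset.univ x y

lemma dotProduct_mulVec_le (M : Matrix ι ι ℝ) (x : ι → ℝ) :
    x ⬝ᵥ (M *ᵥ x) ≤ ‖M‖ * (x ⬝ᵥ x) := by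
  have h1 := sq_dotProduct_le x (M *ᵥ x)
  have h2 := mulVec_dotProduct_self_le M x
  have h3 := dotProduct_self_nonneg_real x
  refine le_of_sq_le_sq (h1.trans ?_) (by positivity)
  calc _ ≤ (x ⬝ᵥ x) * (‖M‖ ^ 2 * (x ⬝ᵥ x)) := by gcongr
    _ = _ := by ring

lemma dotProduct_mulVec_comm_of_isHermitian {M : Matrix ι ι ℝ} (hM : M.IsHermitian)
    (x y : ι → ℝ) : x ⬝ᵥ (M *ᵥ y) = y ⬝ᵥ (M *ᵥ x) := by
  have : Mᵀ = M := by rw [← Matrix.conjTranspose_eq_transpose_of_trivial]; exact hM.eq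
  rw [Matrix.dotProduct_mulVec, ← Matrix.mulVec_transpose, this, dotProduct_comm]

/-- The spectral norm of a symmetric matrix is bounded by its numerical radius. -/
lemma norm_le_of_abs_dotProduct_mulVec_le {M : Matrix ι ι ℝ} (hM : M.IsHermitian) {c : ℝ}
    (hc : 0 ≤ c) (h : ∀ x, |x ⬝ᵥ (M *ᵥ x)| ≤ c * (x ⬝ᵥ x)) : ‖M‖ ≤ c := by
  -- Polarization at `d x ± y` with `y = M x`: the difference of the two forms is `4 d (y ⬝ᵥ y)`,
  -- and the hypothesis bounds it by `2 c (d² (x ⬝ᵥ x) + y ⬝ᵥ y)`. With `c ≤ d` and `d > 0` this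
  -- gives `y ⬝ᵥ y ≤ d² (x ⬝ᵥ x)`. Using `d > c` covers the case `c = 0`.
  have key (d : ℝ) (hd : 0 < d) (hcd : c ≤ d) : ‖M‖ ≤ d := by
    refine norm_le_of_mulVec_dotProduct_self_le hd.le fun x => ?_
    set y : ι → ℝ := M *ᵥ x with hy
    have h1 := (abs_le.1 (h (d • x + y))).2
    have h2 := (abs_le.1 (h (d • x - y))).1
    have h3 : y ⬝ᵥ (M *ᵥ x) = y ⬝ᵥ y := rfl
    have h4 : x ⬝ᵥ (M *ᵥ y) = y ⬝ᵥ y := by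
      rw [dotProduct_mulVec_comm_of_isHermitian hM, h3]
    simp only [Matrix.mulVec_add, Matrix.mulVec_sub, Matrix.mulVec_smul, dotProduct_add,
      add_dotProduct, dotProduct_sub, sub_dotProduct, smul_dotProduct, dotProduct_smul, smul_eq_mul,
      h3, h4] at h1 h2
    have hx := dotProduct_self_nonneg_real x
    have hyy := dotProduct_self_nonneg_real y
    rw [dotProduct_comm y x] at h1 h2
    nlinarith [mul_nonneg (mul_nonneg hd.le hd.le) hx, mul_nonneg (sub_nonneg.2 hcd)
      (add_nonneg (mul_nonneg (mul_nonneg hd.le hd.le) hx) hyy)]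
  refine le_of_forall_pos_le_add fun e he => key (c + e) (by positivity) (by linarith)

lemma Matrix.PosSemidef.nonneg_real {M : Matrix ι ι ℝ} (hM : M.PosSemidef) (x : ι → ℝ) :
    0 ≤ x ⬝ᵥ (M *ᵥ x) := by
  simpa using hM.dotProduct_mulVec_nonneg x

/-- Young's inequality for a positive semidefinite form. -/
lemma Matrix.PosSemidef.young {M : Matrix ι ι ℝ} (hM : M.PosSemidef) {s : ℝ} (hs : 0 < s)
    (a b : ι → ℝ) : (a + b) ⬝ᵥ (M *ᵥ (a + b)) ≤
      (1 + s) * (a ⬝ᵥ (M *ᵥ a)) + (1 + s⁻¹) * (b ⬝ᵥ (M *ᵥ b)) := by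
  have h := hM.nonneg_real (s • a - b)
  have hab := dotProduct_mulVec_comm_of_isHermitian hM.1 a b
  simp only [Matrix.mulVec_add, Matrix.mulVec_sub, Matrix.mulVec_smul, dotProduct_add,
      add_dotProduct, dotProduct_sub, sub_dotProduct, smul_dotProduct, dotProduct_smul, smul_eq_mul]
      at h ⊢
  rw [← hab] at h ⊢
  have h' : 0 ≤ s⁻¹ * (s * (s * (a ⬝ᵥ M *ᵥ a)) - s * (a ⬝ᵥ M *ᵥ b) -
    (s * (a ⬝ᵥ M *ᵥ b) - b ⬝ᵥ M *ᵥ b)) := by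
    refine mul_nonneg (by positivity) ?_
    linarith
  have e : s⁻¹ * (s * (s * (a ⬝ᵥ M *ᵥ a)) - s * (a ⬝ᵥ M *ᵥ b) -
    (s * (a ⬝ᵥ M *ᵥ b) - b ⬝ᵥ M *ᵥ b)) = s * (a ⬝ᵥ M *ᵥ a) - 2 * (a ⬝ᵥ M *ᵥ b)
      + s⁻¹ * (b ⬝ᵥ M *ᵥ b) := by field_simp; ring
  rw [e] at h'
  linarith

lemma dotProduct_transpose_mul_mul_mulVec (M : Matrix ι ι ℝ) (L : Matrix ι κ ℝ) (x : κ → ℝ) :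
    x ⬝ᵥ ((Lᵀ * M * L) *ᵥ x) = (L *ᵥ x) ⬝ᵥ (M *ᵥ (L *ᵥ x)) := by
  rw [Matrix.mul_assoc, ← Matrix.mulVec_mulVec, ← Matrix.mulVec_mulVec, Matrix.dotProduct_mulVec,
    Matrix.vecMul_transpose]

lemma Matrix.PosSemidef.transpose_mul_mul_same {M : Matrix ι ι ℝ} (hM : M.PosSemidef)
    (L : Matrix ι κ ℝ) : (Lᵀ * M * L).PosSemidef := by
  rw [← Matrix.conjTranspose_eq_transpose_of_trivial]; exact hM.conjTranspose_mul_mul_same L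

lemma norm_transpose_eq (M : Matrix ι κ ℝ) : ‖Mᵀ‖ = ‖M‖ := by
  rw [← Matrix.conjTranspose_eq_transpose_of_trivial]; exact Matrix.l2_opNorm_conjTranspose M

end Forms

/-! ### Singular values -/

section SingularValues

variable {ι κ : Type*} [Fintype ι] [Fintype κ] [DecidableEq ι] [DecidableEq κ]

/-- In an orthonormal eigenbasis of `T* T` the form `‖T x‖²` is diagonal with the squared singular
values as entries. Since they are counted from `0`, the least one has index `finrank - 1`. -/
lemma LinearMap.singularValues_mul_norm_le {E F : Type*} [NormedAddCommGroup E]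
    [InnerProductSpace ℝ E] [FiniteDimensional ℝ E] [NormedAddCommGroup F]
    [InnerProductSpace ℝ F] [FiniteDimensional ℝ F] (T : E →ₗ[ℝ] F) (x : E) :
    T.singularValues (Module.finrank ℝ E - 1) ^ 2 * ‖x‖ ^ 2 ≤ ‖T x‖ ^ 2 := by
  rcases Nat.eq_zero_or_pos (Module.finrank ℝ E) with h0 | hpos
  · have := Module.finrank_zero_iff.1 h0
    rw [Subsingleton.elim x 0]; simp
  have hS := T.isSymmetric_adjoint_comp_self
  set b := hS.eigenvectorBasis rfl
  have e1 : ‖T x‖ ^ 2 = ∑ i, hS.eigenvalues rfl i * (b.repr x i) ^ 2 := by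
    rw [← real_inner_self_eq_norm_sq, ← LinearMap.adjoint_inner_right, ← LinearMap.comp_apply,
      ← b.repr.inner_map_map, PiLp.inner_apply]
    refine Finset.sum_congr rfl fun i _ => ?_
    rw [hS.eigenvectorBasis_apply_self_apply rfl]
    simp [b]; ring
  have e2 : ‖x‖ ^ 2 = ∑ i, (b.repr x i) ^ 2 := by
    rw [← b.repr.norm_map, EuclideanSpace.real_norm_sq_eq]
  rw [e1, e2, Finset.mul_sum]
  refine Finset.sum_le_sum fun i _ => mul_le_mul_of_nonneg_right ?_ (sq_nonneg _)
  rw [← T.sq_singularValues_fin rfl i]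
  exact pow_le_pow_left₀ (T.singularValues_nonneg _) (T.singularValues_antitone (by omega)) 2

lemma matrixSingularValue_sq_mul_le (M : Matrix ι κ ℝ) {j : ℕ} (hj : j = Fintype.card κ)
    (x : κ → ℝ) : matrixSingularValue j M ^ 2 * (x ⬝ᵥ x) ≤ (M *ᵥ x) ⬝ᵥ (M *ᵥ x) := by
  have := (Matrix.toEuclideanLin M).singularValues_mul_norm_le (WithLp.toLp 2 x)
  rw [finrank_euclideanSpace, ← hj] at this
  rw [dotProduct_self_eq_norm_sq, dotProduct_self_eq_norm_sq]
  exact this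

lemma matrixSingularValue_le_norm (j : ℕ) (M : Matrix ι κ ℝ) : matrixSingularValue j M ≤ ‖M‖ := by
  unfold matrixSingularValue
  set T := Matrix.toEuclideanLin M
  rcases le_or_gt (Module.finrank ℝ (EuclideanSpace ℝ κ)) (j - 1) with h | h
  · rw [T.singularValues_of_finrank_le h]; positivity
  obtain ⟨v, hv⟩ := (T.hasEigenvalue_adjoint_comp_self_sq_singularValues h).exists_hasEigenvector
  have hv0 : 0 < ‖v‖ := norm_pos_iff.2 hv.2
  have e : ‖T v‖ ^ 2 = T.singularValues (j - 1) ^ 2 * ‖v‖ ^ 2 := by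
    rw [← real_inner_self_eq_norm_sq, ← LinearMap.adjoint_inner_right, ← LinearMap.comp_apply,
      hv.apply_eq_smul, inner_smul_right, real_inner_self_eq_norm_sq]
    rfl
  have h1 : ‖T v‖ ≤ ‖M‖ * ‖v‖ := M.l2_opNorm_mulVec v
  rw [← mul_pow, sq_eq_sq₀ (norm_nonneg _) (mul_nonneg (T.singularValues_nonneg _) hv0.le)] at e
  rw [e] at h1
  exact le_of_mul_le_mul_right h1 hv0

/-- A positive semidefinite matrix whose smallest singular value is at least `1` dominates `I`. -/
lemma dotProduct_self_le_of_one_le_matrixSingularValue {M : Matrix ι ι ℝ} (hM : M.PosSemidef)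
    {j : ℕ} (hj : j = Fintype.card ι) (h : 1 ≤ matrixSingularValue j M) (x : ι → ℝ) :
    x ⬝ᵥ x ≤ x ⬝ᵥ (M *ᵥ x) := by
  have hlow (y : ι → ℝ) : y ⬝ᵥ y ≤ (M *ᵥ y) ⬝ᵥ (M *ᵥ y) := by
    refine le_trans ?_ (matrixSingularValue_sq_mul_le M hj y)
    exact le_mul_of_one_le_left (dotProduct_self_nonneg_real y) (one_le_pow₀ h)
  have hH : (M - 1).IsHermitian := hM.1.sub Matrix.isHermitian_one
  have hpsd : (M - 1).PosSemidef := by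
    rw [hH.posSemidef_iff_eigenvalues_nonneg]
    intro i
    set v : ι → ℝ := WithLp.ofLp (hH.eigenvectorBasis i)
    have hv : v ⬝ᵥ v = 1 := by
      rw [dotProduct_self_eq_norm_sq]
      simp [v]
    have he : M *ᵥ v = (hH.eigenvalues i + 1) • v := by
      have := hH.mulVec_eigenvectorBasis i
      rw [Matrix.sub_mulVec, Matrix.one_mulVec, sub_eq_iff_eq_add] at this
      rw [add_smul, one_smul]; exact this
    have h1 := hlow v
    have h2 := hM.nonneg_real v
    rw [he] at h1 h2
    simp only [smul_dotProduct, dotProduct_smul, hv, smul_eq_mul] at h1 h2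
    simp only [Pi.zero_apply]
    -- For an eigenvalue `λ` of `M - 1`, the lower bound gives `(λ + 1)² ≥ 1` and semidefiniteness
    -- gives `λ + 1 ≥ 0`, so `λ ≥ 0`.
    nlinarith
  have := hpsd.nonneg_real x
  rw [Matrix.sub_mulVec, dotProduct_sub, Matrix.one_mulVec] at this
  linarith

end SingularValues

/-! ### The Riccati recursion -/

section Riccati

variable {n : ℕ} {κ : Type*} [Fintype κ] [DecidableEq κ]
  {A : Matrix (Fin n) (Fin n) ℝ} {B : Matrix (Fin n) κ ℝ} {Q : Matrix (Fin n) (Fin n) ℝ}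
  {R : Matrix κ κ ℝ} {X Qf : Matrix (Fin n) (Fin n) ℝ}

lemma posDef_transpose_mul_mul_add (hX : X.PosSemidef) (hR : R.PosDef) :
    (Bᵀ * X * B + R).PosDef :=
  Matrix.PosDef.posSemidef_add (hX.transpose_mul_mul_same B) hR

/-- Completing the square in one step of dynamic programming. -/
lemma riccatiStep_complete_square (hX : X.PosSemidef) (hR : R.PosDef) (x : Fin n → ℝ)
    (u : κ → ℝ) :
    x ⬝ᵥ (Q *ᵥ x) + u ⬝ᵥ (R *ᵥ u) + (A *ᵥ x + B *ᵥ u) ⬝ᵥ (X *ᵥ (A *ᵥ x + B *ᵥ u)) =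
      x ⬝ᵥ (riccatiStep A B Q R X *ᵥ x) + (u - lqrGain A B R X *ᵥ x) ⬝ᵥ
        ((Bᵀ * X * B + R) *ᵥ (u - lqrGain A B R X *ᵥ x)) := by
  have hM := posDef_transpose_mul_mul_add (B := B) hX hR
  set M := Bᵀ * X * B + R with hMdef
  -- As a function of `u` the left side is `u ⬝ᵥ M u + 2 (u ⬝ᵥ g)` plus a constant, minimized at
  -- `-M⁻¹ g`, which is the Riccati gain applied to `x`.
  set g : κ → ℝ := Bᵀ *ᵥ (X *ᵥ (A *ᵥ x)) with hg
  have hdet : IsUnit M.det := (Matrix.isUnit_iff_isUnit_det _).1 hM.isUnit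
  have hK : lqrGain A B R X *ᵥ x = -(M⁻¹ *ᵥ g) := by
    rw [lqrGain, ← hMdef]
    simp only [Matrix.neg_mulVec, hg, Matrix.mulVec_mulVec, Matrix.mul_assoc]
  have hMK : M *ᵥ (M⁻¹ *ᵥ g) = g := by
    rw [Matrix.mulVec_mulVec, Matrix.mul_nonsing_inv _ hdet, Matrix.one_mulVec]
  have hcross (v : κ → ℝ) (y : Fin n → ℝ) : (B *ᵥ v) ⬝ᵥ y = v ⬝ᵥ (Bᵀ *ᵥ y) := by
    rw [Matrix.dotProduct_mulVec, Matrix.vecMul_transpose]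
  have hMu : u ⬝ᵥ (M *ᵥ u) = (B *ᵥ u) ⬝ᵥ (X *ᵥ (B *ᵥ u)) + u ⬝ᵥ (R *ᵥ u) := by
    rw [hMdef, Matrix.add_mulVec, dotProduct_add, dotProduct_transpose_mul_mul_mulVec]
  have hstep : x ⬝ᵥ (riccatiStep A B Q R X *ᵥ x) =
      x ⬝ᵥ (Q *ᵥ x) + (A *ᵥ x) ⬝ᵥ (X *ᵥ (A *ᵥ x)) - g ⬝ᵥ (M⁻¹ *ᵥ g) := by
    have e : Aᵀ * X * B * M⁻¹ * Bᵀ * X * A = (Bᵀ * X * A)ᵀ * M⁻¹ * (Bᵀ * X * A) := by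
      have hXt : Xᵀ = X := by rw [← Matrix.conjTranspose_eq_transpose_of_trivial]; exact hX.1.eq
      simp only [Matrix.transpose_mul, Matrix.transpose_transpose, hXt, Matrix.mul_assoc]
    rw [riccatiStep, ← hMdef, e, Matrix.sub_mulVec, Matrix.add_mulVec, dotProduct_sub,
      dotProduct_add, dotProduct_transpose_mul_mul_mulVec, dotProduct_transpose_mul_mul_mulVec]
    simp only [hg, Matrix.mulVec_mulVec, Matrix.mul_assoc]
  have hXc : (A *ᵥ x) ⬝ᵥ (X *ᵥ (B *ᵥ u)) = u ⬝ᵥ g := by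
    rw [dotProduct_mulVec_comm_of_isHermitian hX.1, hcross]
  have hXc' : (B *ᵥ u) ⬝ᵥ (X *ᵥ (A *ᵥ x)) = u ⬝ᵥ g := hcross _ _
  have h1 : (M⁻¹ *ᵥ g) ⬝ᵥ (M *ᵥ u) = u ⬝ᵥ g := by
    rw [dotProduct_mulVec_comm_of_isHermitian hM.1, hMK]
  rw [hK, hstep]
  simp only [Matrix.mulVec_add, sub_neg_eq_add,
    dotProduct_add, add_dotProduct, hMu, hXc, hXc', hMK, h1]
  rw [dotProduct_comm (M⁻¹ *ᵥ g) g]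
  ring

/-- At the optimal input the completed square vanishes, so the form equals a sum of nonnegative
costs. -/
lemma riccatiStep_posSemidef (hX : X.PosSemidef) (hQ : Q.PosSemidef) (hR : R.PosDef) :
    (riccatiStep A B Q R X).PosSemidef := by
  have hM := posDef_transpose_mul_mul_add (B := B) hX hR
  refine Matrix.PosSemidef.of_dotProduct_mulVec_nonneg ?_ fun x => ?_
  · have e : Aᵀ * X * B * (Bᵀ * X * B + R)⁻¹ * Bᵀ * X * A =
        (Bᵀ * X * A)ᵀ * (Bᵀ * X * B + R)⁻¹ * (Bᵀ * X * A) := by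
      have hXt : Xᵀ = X := by rw [← Matrix.conjTranspose_eq_transpose_of_trivial]; exact hX.1.eq
      simp only [Matrix.transpose_mul, Matrix.transpose_transpose, hXt, Matrix.mul_assoc]
    rw [riccatiStep, e]
    exact (hQ.1.add (hX.transpose_mul_mul_same A).1).sub
      (hM.inv.posSemidef.transpose_mul_mul_same _).1
  · have h := riccatiStep_complete_square (A := A) (B := B) (Q := Q) hX hR x (lqrGain A B R X *ᵥ x)
    rw [sub_self, zero_dotProduct, add_zero] at h
    rw [star_trivial, ← h]
    have h1 := hQ.nonneg_real x
    have h2 := hR.posSemidef.nonneg_real (lqrGain A B R X *ᵥ x)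
    have h3 := hX.nonneg_real (A *ᵥ x + B *ᵥ (lqrGain A B R X *ᵥ x))
    positivity

lemma riccatiP_self (N : ℕ) : riccatiP A B Q R Qf N N = Qf := by simp [riccatiP]

lemma riccatiP_of_lt {N k : ℕ} (hk : k < N) :
    riccatiP A B Q R Qf N k = riccatiStep A B Q R (riccatiP A B Q R Qf N (k + 1)) := by
  rw [riccatiP, riccatiP, show N - k = N - (k + 1) + 1 by omega, Function.iterate_succ_apply']

lemma riccatiP_posSemidef (hQ : Q.PosSemidef) (hR : R.PosDef) (hQf : Qf.PosSemidef) (N k : ℕ) :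
    (riccatiP A B Q R Qf N k).PosSemidef := by
  rw [riccatiP]
  induction N - k with
  | zero => exact hQf
  | succ j ih => rw [Function.iterate_succ_apply']; exact riccatiStep_posSemidef ih hQ hR

/-- Completing the square along the Riccati recursion. -/
lemma riccatiP_complete_square (hQ : Q.PosSemidef) (hR : R.PosDef) (hQf : Qf.PosSemidef)
    {N k : ℕ} (hk : k < N) (x : Fin n → ℝ) (u : κ → ℝ) :
    x ⬝ᵥ (Q *ᵥ x) + u ⬝ᵥ (R *ᵥ u) + (A *ᵥ x + B *ᵥ u) ⬝ᵥ
        (riccatiP A B Q R Qf N (k + 1) *ᵥ (A *ᵥ x + B *ᵥ u)) =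
      x ⬝ᵥ (riccatiP A B Q R Qf N k *ᵥ x) + (u - riccatiK A B Q R Qf N k *ᵥ x) ⬝ᵥ
        ((Bᵀ * riccatiP A B Q R Qf N (k + 1) * B + R) *ᵥ
          (u - riccatiK A B Q R Qf N k *ᵥ x)) := by
  rw [riccatiP_of_lt hk]
  exact riccatiStep_complete_square (riccatiP_posSemidef hQ hR hQf N (k + 1)) hR x u

/-- Bellman's inequality: an arbitrary input, in particular one designed for another system, cannot
beat the optimum. The next lemma is the case of equality. -/
lemma riccatiP_le (hQ : Q.PosSemidef) (hR : R.PosDef) (hQf : Qf.PosSemidef)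
    {N k : ℕ} (hk : k < N) (x : Fin n → ℝ) (u : κ → ℝ) :
    x ⬝ᵥ (riccatiP A B Q R Qf N k *ᵥ x) ≤ x ⬝ᵥ (Q *ᵥ x) + u ⬝ᵥ (R *ᵥ u) +
      (A *ᵥ x + B *ᵥ u) ⬝ᵥ (riccatiP A B Q R Qf N (k + 1) *ᵥ (A *ᵥ x + B *ᵥ u)) := by
  rw [riccatiP_complete_square hQ hR hQf hk]
  have h := (posDef_transpose_mul_mul_add (B := B) (riccatiP_posSemidef (A := A) (B := B)
    hQ hR hQf N (k + 1)) hR).posSemidef.nonneg_real (u - riccatiK A B Q R Qf N k *ᵥ x)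
  linarith

lemma riccatiP_eq (hQ : Q.PosSemidef) (hR : R.PosDef) (hQf : Qf.PosSemidef)
    {N k : ℕ} (hk : k < N) (x : Fin n → ℝ) {u : κ → ℝ} (hu : u = riccatiK A B Q R Qf N k *ᵥ x) :
    x ⬝ᵥ (riccatiP A B Q R Qf N k *ᵥ x) = x ⬝ᵥ (Q *ᵥ x) + u ⬝ᵥ (R *ᵥ u) +
      (A *ᵥ x + B *ᵥ u) ⬝ᵥ (riccatiP A B Q R Qf N (k + 1) *ᵥ (A *ᵥ x + B *ᵥ u)) := by
  rw [riccatiP_complete_square hQ hR hQf hk, ← hu, sub_self, zero_dotProduct, add_zero]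

variable {A' : Matrix (Fin n) (Fin n) ℝ} {B' : Matrix (Fin n) κ ℝ}

/-- One-sided perturbation bound for the Riccati recursion: since `Q ≥ I` and `R ≥ I`, the value
function of `(A, B)` is a Lyapunov function for its optimal feedback applied to `(A', B')`. -/
lemma riccatiP_perturbation_le (hQ : Q.PosSemidef) (hR : R.PosDef) (hQf : Qf.PosSemidef)
    (hQ1 : ∀ x, x ⬝ᵥ x ≤ x ⬝ᵥ (Q *ᵥ x)) (hR1 : ∀ u, u ⬝ᵥ u ≤ u ⬝ᵥ (R *ᵥ u))
    {ε G ρ : ℝ} (hε : 0 < ε) (hA : ‖A - A'‖ ≤ ε) (hB : ‖B - B'‖ ≤ ε) (hG : 1 ≤ G)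
    (hεG : 4 * ε * G ≤ 1) (hρ : 0 ≤ ρ) (hρ1 : 1 ≤ ρ * (1 - 5 * G ^ 2 * ε)) {N k₀ : ℕ}
    (hP : ∀ k, k₀ ≤ k → k ≤ N → ∀ x, x ⬝ᵥ (riccatiP A B Q R Qf N k *ᵥ x) ≤ G * (x ⬝ᵥ x))
    {k : ℕ} (hk₀ : k₀ ≤ k) (hk : k ≤ N) (x : Fin n → ℝ) :
    x ⬝ᵥ (riccatiP A' B' Q R Qf N k *ᵥ x) ≤ ρ * (x ⬝ᵥ (riccatiP A B Q R Qf N k *ᵥ x)) := by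
  induction hk using Nat.decreasingInduction generalizing x with
  | self =>
    rw [riccatiP_self, riccatiP_self]
    have h0 := hQf.nonneg_real x
    refine le_mul_of_one_le_left h0 ?_
    have : 0 ≤ ρ * (5 * G ^ 2 * ε) := by positivity
    linarith
  | of_succ k hk ih =>
    have ih := ih (by omega)
    set u : κ → ℝ := riccatiK A B Q R Qf N k *ᵥ x with hu
    have h1 := riccatiP_eq hQ hR hQf hk x hu
    have h2 := riccatiP_le (A := A') (B := B') hQ hR hQf hk x u
    have h3 := hP k hk₀ hk.le x
    have hxx := dotProduct_self_nonneg_real x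
    have hPp := riccatiP_posSemidef (A := A) (B := B) hQ hR hQf N (k + 1)
    set P := riccatiP A B Q R Qf N (k + 1)
    set a := A *ᵥ x + B *ᵥ u with ha
    -- The optimal input for `(A, B)` sends the other system to `a + b`, where `b` is the model
    -- error.
    set b := (A' - A) *ᵥ x + (B' - B) *ᵥ u with hb
    have hab : A' *ᵥ x + B' *ᵥ u = a + b := by
      rw [ha, hb, Matrix.sub_mulVec, Matrix.sub_mulVec]; abel
    have hPa := hPp.nonneg_real a
    have huG : u ⬝ᵥ u ≤ G * (x ⬝ᵥ x) := by
      have := hR1 u; have := hQ1 x; linarith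
    have hPaG : a ⬝ᵥ (P *ᵥ a) ≤ G * (x ⬝ᵥ x) := by
      have := hR1 u; have := hQ1 x; have := dotProduct_self_nonneg_real u; linarith
    have hbb : b ⬝ᵥ b ≤ (2 * ε * G) ^ 2 * (x ⬝ᵥ x) := by
      have e1 := mulVec_dotProduct_self_le_of_norm_le ((norm_sub_rev _ _).trans_le hA) x
      have e2 := mulVec_dotProduct_self_le_of_norm_le ((norm_sub_rev _ _).trans_le hB) u
      have e3 := dotProduct_self_nonneg_real ((A' - A) *ᵥ x - (B' - B) *ᵥ u)
      simp only [dotProduct_sub, sub_dotProduct] at e3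
      have e4 : b ⬝ᵥ b ≤ 2 * (((A' - A) *ᵥ x) ⬝ᵥ ((A' - A) *ᵥ x)) +
          2 * (((B' - B) *ᵥ u) ⬝ᵥ ((B' - B) *ᵥ u)) := by
        simp only [hb, dotProduct_add, add_dotProduct]
        linarith
      calc b ⬝ᵥ b ≤ 2 * (ε ^ 2 * (x ⬝ᵥ x)) + 2 * (ε ^ 2 * (G * (x ⬝ᵥ x))) := by
            have := mul_le_mul_of_nonneg_left huG (sq_nonneg ε); linarith
        _ = (2 * ε ^ 2 * (1 + G)) * (x ⬝ᵥ x) := by ring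
        _ ≤ _ := by
          refine mul_le_mul_of_nonneg_right ?_ hxx
          have : 1 + G ≤ 2 * G ^ 2 := by nlinarith
          nlinarith [mul_le_mul_of_nonneg_left this (sq_nonneg ε)]
    have hPb : b ⬝ᵥ (P *ᵥ b) ≤ G * ((2 * ε * G) ^ 2 * (x ⬝ᵥ x)) :=
      (hP (k + 1) (by omega) hk b).trans (by gcongr)
    -- The weight `2 ε G` balances Young's inequality: the `a` term costs `2 ε G²`, and the `b` term
    -- at most `3 ε G²` because `2 ε G ≤ 1 / 2`.
    have hy := hPp.young (s := 2 * ε * G) (by positivity) a b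
    have hmain : (a + b) ⬝ᵥ (P *ᵥ (a + b)) ≤ a ⬝ᵥ (P *ᵥ a) + 5 * G ^ 2 * ε * (x ⬝ᵥ x) := by
      have e1 : 2 * ε * G * (a ⬝ᵥ (P *ᵥ a)) ≤ 2 * ε * G * (G * (x ⬝ᵥ x)) := by gcongr
      have e2 : (1 + (2 * ε * G)⁻¹) * (b ⬝ᵥ (P *ᵥ b)) ≤
          (1 + (2 * ε * G)⁻¹) * (G * ((2 * ε * G) ^ 2 * (x ⬝ᵥ x))) := by gcongr
      have e3 : (1 + (2 * ε * G)⁻¹) * (G * ((2 * ε * G) ^ 2 * (x ⬝ᵥ x))) =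
          (2 * ε * G + 1) * (2 * ε * G * G * (x ⬝ᵥ x)) := by field_simp
      have e4 : (2 * ε * G + 1) * (2 * ε * G * G * (x ⬝ᵥ x)) ≤
          (3 / 2) * (2 * ε * G * G * (x ⬝ᵥ x)) := by
        gcongr; linarith
      nlinarith
    have ihx := ih (a + b)
    have e5 : ρ * ((a + b) ⬝ᵥ (P *ᵥ (a + b))) ≤
        ρ * (a ⬝ᵥ (P *ᵥ a) + 5 * G ^ 2 * ε * (x ⬝ᵥ x)) := by gcongr
    rw [hab] at h2
    have huR : 0 ≤ u ⬝ᵥ (R *ᵥ u) := hR.posSemidef.nonneg_real u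
    have hρ2 : 0 ≤ ρ - 1 := by
      have : 0 ≤ ρ * (5 * G ^ 2 * ε) := by positivity
      linarith
    -- The slack `ρ - 1` times the stage cost, which is at least `x ⬝ᵥ x`, absorbs the one-step
    -- error `5 ρ G² ε (x ⬝ᵥ x)`. Thus the same `ρ` survives every backward step, whatever the
    -- horizon.
    have e6 : (ρ - 1) * (x ⬝ᵥ x) ≤ (ρ - 1) * (x ⬝ᵥ (Q *ᵥ x) + u ⬝ᵥ (R *ᵥ u)) := by
      gcongr
      have := hQ1 x; linarith
    have e7 : ρ * (5 * G ^ 2 * ε) * (x ⬝ᵥ x) ≤ (ρ - 1) * (x ⬝ᵥ x) := by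
      gcongr; linarith
    rw [h1]
    linarith

/-- With `y = G² ε`, the choice `ρ = 1 + 6 y` is admissible because `(1 + 6 y) (1 - 5 y) ≥ 1` when
`30 y ≤ 1`. Inserting `P ≤ G` makes the multiplicative bound additive. -/
lemma riccatiP_perturbation_le_add (hQ : Q.PosSemidef) (hR : R.PosDef) (hQf : Qf.PosSemidef)
    (hQ1 : ∀ x, x ⬝ᵥ x ≤ x ⬝ᵥ (Q *ᵥ x)) (hR1 : ∀ u, u ⬝ᵥ u ≤ u ⬝ᵥ (R *ᵥ u))
    {ε G : ℝ} (hε : 0 < ε) (hA : ‖A - A'‖ ≤ ε) (hB : ‖B - B'‖ ≤ ε) (hG : 1 ≤ G)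
    (hεG : 30 * G ^ 2 * ε ≤ 1) {N k₀ : ℕ}
    (hP : ∀ k, k₀ ≤ k → k ≤ N → ∀ x, x ⬝ᵥ (riccatiP A B Q R Qf N k *ᵥ x) ≤ G * (x ⬝ᵥ x))
    {k : ℕ} (hk₀ : k₀ ≤ k) (hk : k ≤ N) (x : Fin n → ℝ) :
    x ⬝ᵥ (riccatiP A' B' Q R Qf N k *ᵥ x) ≤ x ⬝ᵥ (riccatiP A B Q R Qf N k *ᵥ x) +
      6 * G ^ 3 * ε * (x ⬝ᵥ x) := by
  have hGG : G ≤ G ^ 2 := by nlinarith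
  have h := riccatiP_perturbation_le (ρ := 1 + 6 * G ^ 2 * ε) hQ hR hQf hQ1 hR1 hε hA hB hG
    (by nlinarith) (by positivity) (by nlinarith [mul_nonneg (sq_nonneg G) hε.le]) hP hk₀ hk x
  have h2 := mul_le_mul_of_nonneg_left (hP k hk₀ hk x) (by positivity : 0 ≤ 6 * G ^ 2 * ε)
  nlinarith

/-- Perturbation bound for the Riccati recursion. -/
lemma norm_riccatiP_sub_le (hQ : Q.PosSemidef) (hR : R.PosDef) (hQf : Qf.PosSemidef)
    (hQ1 : ∀ x, x ⬝ᵥ x ≤ x ⬝ᵥ (Q *ᵥ x)) (hR1 : ∀ u, u ⬝ᵥ u ≤ u ⬝ᵥ (R *ᵥ u))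
    {ε g : ℝ} (hε : 0 < ε) (hA : ‖A - A'‖ ≤ ε) (hB : ‖B - B'‖ ≤ ε) (hg : 0 ≤ g)
    (hεg : 30 * (1 + g) ^ 3 * ε ≤ 1) {N k₀ : ℕ}
    (hP : ∀ k, k₀ ≤ k → k ≤ N → ‖riccatiP A B Q R Qf N k‖ ≤ g)
    {k : ℕ} (hk₀ : k₀ ≤ k) (hk : k ≤ N) :
    ‖riccatiP A' B' Q R Qf N k - riccatiP A B Q R Qf N k‖ ≤ 6 * (1 + g) ^ 3 * ε := by
  have hG : 1 ≤ 1 + g := by linarith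
  have hεG : 30 * (1 + g) ^ 2 * ε ≤ 1 := by
    refine le_trans ?_ hεg
    gcongr
    norm_num
  have hPg (k : ℕ) (h1 : k₀ ≤ k) (h2 : k ≤ N) (x : Fin n → ℝ) :
      x ⬝ᵥ (riccatiP A B Q R Qf N k *ᵥ x) ≤ g * (x ⬝ᵥ x) :=
    (dotProduct_mulVec_le _ x).trans
      (mul_le_mul_of_nonneg_right (hP k h1 h2) (dotProduct_self_nonneg_real x))
  have hPG (k : ℕ) (h1 : k₀ ≤ k) (h2 : k ≤ N) (x : Fin n → ℝ) :
      x ⬝ᵥ (riccatiP A B Q R Qf N k *ᵥ x) ≤ (1 + g) * (x ⬝ᵥ x) :=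
    (hPg k h1 h2 x).trans
      (mul_le_mul_of_nonneg_right (by linarith) (dotProduct_self_nonneg_real x))
  have upper (k : ℕ) (h1 : k₀ ≤ k) (h2 : k ≤ N) (x : Fin n → ℝ) :=
    riccatiP_perturbation_le_add hQ hR hQf hQ1 hR1 hε hA hB hG hεG hPG h1 h2 x
  -- The reverse comparison needs an a priori bound on the perturbed solution. The upper estimate
  -- gives `g + 6 (1 + g)³ ε ≤ 1 + g`, so the same constant serves both directions.
  have hPG' (k : ℕ) (h1 : k₀ ≤ k) (h2 : k ≤ N) (x : Fin n → ℝ) :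
      x ⬝ᵥ (riccatiP A' B' Q R Qf N k *ᵥ x) ≤ (1 + g) * (x ⬝ᵥ x) := by
    have e1 := upper k h1 h2 x
    have e2 := hPg k h1 h2 x
    have e3 : 6 * (1 + g) ^ 3 * ε * (x ⬝ᵥ x) ≤ 1 * (x ⬝ᵥ x) :=
      mul_le_mul_of_nonneg_right (by linarith [show 0 ≤ (1 + g) ^ 3 * ε by positivity])
        (dotProduct_self_nonneg_real x)
    linarith
  have lower := riccatiP_perturbation_le_add hQ hR hQf hQ1 hR1 hε
    ((norm_sub_rev _ _).trans_le hA) ((norm_sub_rev _ _).trans_le hB) hG hεG hPG' hk₀ hk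
  refine norm_le_of_abs_dotProduct_mulVec_le ((riccatiP_posSemidef hQ hR hQf N k).1.sub
    (riccatiP_posSemidef hQ hR hQf N k).1) (by positivity) fun x => ?_
  rw [Matrix.sub_mulVec, dotProduct_sub, abs_le]
  have e1 := upper k hk₀ hk x
  have e2 := lower x
  constructor <;> linarith

/-- The gain is Lipschitz in the system matrices and the value matrix. -/
lemma norm_lqrGain_sub_le {X' : Matrix (Fin n) (Fin n) ℝ} (hX : X.PosSemidef)
    (hX' : X'.PosSemidef) (hR : R.PosDef) (hR1 : ∀ u, u ⬝ᵥ u ≤ u ⬝ᵥ (R *ᵥ u))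
    {ε g δ : ℝ} (hε : 0 < ε) (hε1 : ε ≤ 1) (hA : ‖A - A'‖ ≤ ε) (hB : ‖B - B'‖ ≤ ε)
    (hAg : ‖A‖ ≤ g) (hBg : ‖B‖ ≤ g) (hXg : ‖X‖ ≤ g) (hKg : ‖lqrGain A B R X‖ ≤ g)
    (hXX : ‖X' - X‖ ≤ δ) (hεδ : ε ≤ δ) :
    ‖lqrGain A' B' R X' - lqrGain A B R X‖ ≤ 3 * (1 + g) ^ 3 * δ := by
  have hg : 0 ≤ g := (norm_nonneg _).trans hAg
  have hδ : 0 ≤ δ := (norm_nonneg _).trans hXX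
  have hdet : IsUnit (Bᵀ * X * B + R).det :=
    (Matrix.isUnit_iff_isUnit_det _).1 (posDef_transpose_mul_mul_add hX hR).isUnit
  have hdet' : IsUnit (B'ᵀ * X' * B' + R).det :=
    (Matrix.isUnit_iff_isUnit_det _).1 (posDef_transpose_mul_mul_add hX' hR).isUnit
  set K := lqrGain A B R X with hK
  set K' := lqrGain A' B' R X' with hK'
  have e1 : (Bᵀ * X * B + R) * K = -(Bᵀ * X * A) := by
    rw [hK, lqrGain, Matrix.mul_neg, Matrix.mul_assoc _ Bᵀ, Matrix.mul_assoc _ (Bᵀ * X),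
      Matrix.mul_nonsing_inv_cancel_left _ _ hdet]
  have e1' : (B'ᵀ * X' * B' + R) * K' = -(B'ᵀ * X' * A') := by
    rw [hK', lqrGain, Matrix.mul_neg, Matrix.mul_assoc _ B'ᵀ, Matrix.mul_assoc _ (B'ᵀ * X'),
      Matrix.mul_nonsing_inv_cancel_left _ _ hdet']
  set F := A + B * K with hF
  set E := (A' - A) + (B' - B) * K with hE
  have hFE : A' + B' * K = F + E := by rw [hF, hE, Matrix.sub_mul]; abel
  -- Subtracting the normal equations of the two gains gives the residual `B'ᵀ X' (A' + B' K) - Bᵀ X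
  -- (A + B K)`. It is telescoped so that every summand contains one small factor and has norm at
  -- most `(1 + g)³ δ`.
  set Z := B'ᵀ * ((X' - X) * (F + E)) + ((B' - B)ᵀ * (X * (F + E)) + Bᵀ * (X * E)) with hZ
  have e2 : (B'ᵀ * X' * B' + R) * (K' - K) = -Z := by
    have e3 : Z = B'ᵀ * X' * (A' + B' * K) - Bᵀ * X * F := by
      rw [hFE, hZ, Matrix.transpose_sub]
      simp only [Matrix.sub_mul, Matrix.mul_sub, Matrix.mul_add, Matrix.mul_assoc]
      abel
    rw [e3, Matrix.mul_sub, e1', hF]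
    have e4 : R * K = -(Bᵀ * X * A) - Bᵀ * X * B * K := by rw [← e1, Matrix.add_mul]; abel
    rw [Matrix.add_mul _ R K, e4]
    simp only [Matrix.mul_add, Matrix.mul_assoc]
    abel
  have hFn : ‖F‖ ≤ g * (1 + g) := by
    calc ‖F‖ ≤ ‖A‖ + ‖B‖ * ‖K‖ :=
          (norm_add_le _ _).trans (add_le_add_right (Matrix.l2_opNorm_mul _ _) _)
      _ ≤ g + g * g := by gcongr
      _ = _ := by ring
  have hEn : ‖E‖ ≤ ε * (1 + g) := by
    calc ‖E‖ ≤ ‖A' - A‖ + ‖B' - B‖ * ‖K‖ :=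
          (norm_add_le _ _).trans (add_le_add_right (Matrix.l2_opNorm_mul _ _) _)
      _ ≤ ε + ε * g := by
        rw [norm_sub_rev A', norm_sub_rev B']; gcongr
      _ = _ := by ring
  have hFEn : ‖F + E‖ ≤ (1 + g) ^ 2 := by
    calc ‖F + E‖ ≤ g * (1 + g) + ε * (1 + g) := (norm_add_le _ _).trans (add_le_add hFn hEn)
      _ ≤ g * (1 + g) + 1 * (1 + g) := by gcongr
      _ = _ := by ring
  have hB'n : ‖B'ᵀ‖ ≤ 1 + g := by
    rw [norm_transpose_eq]
    have : ‖B'‖ ≤ ‖B‖ + ‖B - B'‖ := norm_le_norm_add_norm_sub _ _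
    linarith
  have hZn : ‖Z‖ ≤ 3 * (1 + g) ^ 3 * δ := by
    have z1 : ‖B'ᵀ * ((X' - X) * (F + E))‖ ≤ (1 + g) * (δ * (1 + g) ^ 2) :=
      (Matrix.l2_opNorm_mul _ _).trans <| mul_le_mul hB'n ((Matrix.l2_opNorm_mul _ _).trans <|
        mul_le_mul hXX hFEn (norm_nonneg _) hδ) (norm_nonneg _) (by positivity)
    have z2 : ‖(B' - B)ᵀ * (X * (F + E))‖ ≤ ε * (g * (1 + g) ^ 2) :=
      (Matrix.l2_opNorm_mul _ _).trans <| mul_le_mul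
        (by rw [norm_transpose_eq, norm_sub_rev]; exact hB) ((Matrix.l2_opNorm_mul _ _).trans <|
        mul_le_mul hXg hFEn (norm_nonneg _) hg) (norm_nonneg _) hε.le
    have z3 : ‖Bᵀ * (X * E)‖ ≤ g * (g * (ε * (1 + g))) :=
      (Matrix.l2_opNorm_mul _ _).trans <| mul_le_mul
        (by rw [norm_transpose_eq]; exact hBg) ((Matrix.l2_opNorm_mul _ _).trans <|
        mul_le_mul hXg hEn (norm_nonneg _) hg) (norm_nonneg _) hg
    calc ‖Z‖ ≤ (1 + g) * (δ * (1 + g) ^ 2) + (ε * (g * (1 + g) ^ 2) + g * (g * (ε * (1 + g)))) :=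
          (norm_add_le _ _).trans (add_le_add z1 ((norm_add_le _ _).trans (add_le_add z2 z3)))
      _ ≤ (1 + g) * (δ * (1 + g) ^ 2) + (δ * ((1 + g) * (1 + g) ^ 2)
          + (1 + g) * ((1 + g) * (δ * (1 + g)))) := by gcongr <;> linarith
      _ = _ := by ring
  refine norm_le_of_mulVec_dotProduct_self_le (by positivity) fun x => ?_
  set y := (K' - K) *ᵥ x with hy
  -- Since `B'ᵀ X' B' + R ≥ R ≥ I`, testing against `y` gives `y ⬝ᵥ y ≤ -(y ⬝ᵥ Z x)`, so
  -- Cauchy–Schwarz suffices and no inverse has to be estimated.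
  have hyz : y ⬝ᵥ y ≤ y ⬝ᵥ (-(Z *ᵥ x)) := by
    rw [← Matrix.neg_mulVec, ← e2, ← Matrix.mulVec_mulVec, Matrix.add_mulVec, dotProduct_add,
      dotProduct_transpose_mul_mul_mulVec]
    have := hR1 y
    have := hX'.nonneg_real (B' *ᵥ y)
    linarith
  have hcs := sq_dotProduct_le y (-(Z *ᵥ x))
  rw [neg_dotProduct_neg] at hcs
  have hZx := mulVec_dotProduct_self_le_of_norm_le hZn x
  have hyy := dotProduct_self_nonneg_real y
  refine le_trans ?_ hZx
  rcases hyy.eq_or_lt with h0 | h0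
  · rw [← h0]; exact dotProduct_self_nonneg_real _
  · have : (y ⬝ᵥ y) ^ 2 ≤ (y ⬝ᵥ y) * ((Z *ᵥ x) ⬝ᵥ (Z *ᵥ x)) :=
      (pow_le_pow_left₀ hyy hyz 2).trans hcs
    rw [sq] at this
    exact le_of_mul_le_mul_left this h0

end Riccati

/-! ### Transition matrices -/

section Transition

variable {n : ℕ} {M M' : ℕ → Matrix (Fin n) (Fin n) ℝ}

lemma transitionMatrix_self (k : ℕ) : transitionMatrix M k k = 1 := by
  cases k <;> simp [transitionMatrix]

lemma transitionMatrix_succ_right {k₁ k₂ : ℕ} (h : k₁ ≤ k₂) :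
    transitionMatrix M k₁ (k₂ + 1) = M k₂ * transitionMatrix M k₁ k₂ := by
  rw [transitionMatrix, if_neg (by omega)]

lemma transitionMatrix_succ_left {k₁ k₂ : ℕ} (h : k₁ < k₂) :
    transitionMatrix M (k₁ + 1) k₂ * M k₁ = transitionMatrix M k₁ k₂ := by
  induction k₂, h using Nat.le_induction with
  | base => rw [transitionMatrix_self, transitionMatrix_succ_right le_rfl, transitionMatrix_self,
      Matrix.one_mul, Matrix.mul_one]
  | succ k hk ih => rw [transitionMatrix_succ_right hk, transitionMatrix_succ_right (by omega),
      Matrix.mul_assoc, ih]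

/-- Robustness of exponential stability: a perturbation of size `δ` of every factor changes the
rate from `η` to `η + ζ δ`. -/
lemma norm_transitionMatrix_le_of_perturbation {N : ℕ} {ζ η δ : ℝ} (hζ : 0 ≤ ζ) (hη : 0 ≤ η)
    (hM : ∀ k₁ k₂, k₁ ≤ k₂ → k₂ ≤ N → ‖transitionMatrix M k₁ k₂‖ ≤ ζ * η ^ (k₂ - k₁))
    (hδ : ∀ k < N, ‖M' k - M k‖ ≤ δ) {k₁ k₂ : ℕ} (h₁ : k₁ ≤ k₂) (h₂ : k₂ ≤ N) :
    ‖transitionMatrix M' k₁ k₂‖ ≤ ζ * (η + ζ * δ) ^ (k₂ - k₁) := by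
  -- The induction carries the mixed product, perturbed up to `k₂` and unperturbed afterwards. Then
  -- `M' k = M k + (M' k - M k)` can be split in front of an unperturbed block, and the prefactor
  -- stays `ζ` instead of accumulating powers.
  have key : ∀ j, k₂ ≤ j → j ≤ N → ‖transitionMatrix M k₂ j * transitionMatrix M' k₁ k₂‖ ≤
      ζ * (η + ζ * δ) ^ (k₂ - k₁) * η ^ (j - k₂) := by
    induction k₂, h₁ using Nat.le_induction with
    | base =>
      intro j h1 h2
      simpa [transitionMatrix_self] using hM k₁ j h1 h2
    | succ k hk ih =>
      intro j h1 h2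
      have hδ0 : 0 ≤ δ := (norm_nonneg _).trans (hδ k (by omega))
      have e : transitionMatrix M (k + 1) j * transitionMatrix M' k₁ (k + 1) =
          transitionMatrix M k j * transitionMatrix M' k₁ k +
          transitionMatrix M (k + 1) j * ((M' k - M k) * transitionMatrix M' k₁ k) := by
        rw [transitionMatrix_succ_right hk, ← transitionMatrix_succ_left (M := M) (k₁ := k) (k₂ := j) (by omega),
          Matrix.sub_mul, Matrix.mul_sub, Matrix.mul_assoc]
        abel
      have i1 := ih (by omega) j (by omega) h2
      have i2 := ih (by omega) k le_rfl (by omega)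
      rw [transitionMatrix_self, Matrix.one_mul, Nat.sub_self, pow_zero, mul_one] at i2
      have hm : k + 1 - k₁ = (k - k₁) + 1 := by omega
      have hj : j - k = (j - (k + 1)) + 1 := by omega
      rw [e, hm]
      rw [hj] at i1
      calc _ ≤ ζ * (η + ζ * δ) ^ (k - k₁) * η ^ (j - (k + 1) + 1) +
            ζ * η ^ (j - (k + 1)) * (δ * (ζ * (η + ζ * δ) ^ (k - k₁))) := by
            refine (norm_add_le _ _).trans (add_le_add i1 ?_)
            refine (Matrix.l2_opNorm_mul _ _).trans (mul_le_mul (hM _ _ h1 h2) ?_ (norm_nonneg _)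
              (by positivity))
            exact (Matrix.l2_opNorm_mul _ _).trans
              (mul_le_mul (hδ k (by omega)) i2 (norm_nonneg _) hδ0)
        _ = _ := by ring
  simpa [transitionMatrix_self] using key k₂ le_rfl h₂

end Transition

/-! ### Selecting actuators -/

section Selection

variable {n q : ℕ} {m : Fin q → ℕ}

lemma selIncl_injective (S : Finset (Fin q)) : Function.Injective (selIncl (m := m) S) := by
  rintro ⟨⟨i, hi⟩, a⟩ ⟨⟨j, hj⟩, b⟩ h
  simp only [selIncl, Sigma.mk.injEq] at h
  obtain ⟨rfl, h⟩ := h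
  simp_all

/-- The matrix that extends an input of the selected actuators by zero. -/
def selMatrix (m : Fin q → ℕ) (S : Finset (Fin q)) : Matrix (AllInputs m) (SelInputs m S) ℝ :=
  (1 : Matrix (AllInputs m) (AllInputs m) ℝ).submatrix id (selIncl S)

/-- The columns are distinct standard basis vectors, so extension by zero is an isometry. This
transfers bounds for `B` and `R` to `selB` and `selR`. -/
lemma selMatrix_transpose_mul_self (S : Finset (Fin q)) :
    (selMatrix m S)ᵀ * selMatrix m S = 1 := by
  rw [selMatrix, Matrix.transpose_submatrix, Matrix.transpose_one,
    ← Matrix.submatrix_mul _ _ _ _ _ Function.bijective_id, Matrix.one_mul]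
  exact Matrix.submatrix_one _ (selIncl_injective S)

lemma selB_eq_mul (B : Matrix (Fin n) (AllInputs m) ℝ) (S : Finset (Fin q)) :
    selB B S = B * selMatrix m S := by
  ext i j
  simp [selB, selMatrix, Matrix.mul_apply, Matrix.one_apply]

lemma selR_eq_mul (R : Matrix (AllInputs m) (AllInputs m) ℝ) (S : Finset (Fin q)) :
    selR R S = (selMatrix m S)ᵀ * R * selMatrix m S := by
  ext i j
  simp [selR, selMatrix, Matrix.mul_apply, Matrix.one_apply]

lemma selMatrix_mulVec_dotProduct_self (S : Finset (Fin q)) (x : SelInputs m S → ℝ) :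
    (selMatrix m S *ᵥ x) ⬝ᵥ (selMatrix m S *ᵥ x) = x ⬝ᵥ x := by
  have h := dotProduct_transpose_mul_mul_mulVec (1 : Matrix (AllInputs m) (AllInputs m) ℝ)
    (selMatrix m S) x
  rw [Matrix.mul_one, selMatrix_transpose_mul_self, Matrix.one_mulVec, Matrix.one_mulVec] at h
  exact h.symm

lemma norm_selB_le (B : Matrix (Fin n) (AllInputs m) ℝ) (S : Finset (Fin q)) :
    ‖selB B S‖ ≤ ‖B‖ := by
  have h : ‖selMatrix m S‖ ≤ 1 := norm_le_of_mulVec_dotProduct_self_le zero_le_one fun x => by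
    rw [selMatrix_mulVec_dotProduct_self]; simp
  rw [selB_eq_mul]
  exact (Matrix.l2_opNorm_mul _ _).trans (mul_le_of_le_one_right (norm_nonneg _) h)

lemma selB_sub (B B' : Matrix (Fin n) (AllInputs m) ℝ) (S : Finset (Fin q)) :
    selB B S - selB B' S = selB (B - B') S := rfl

lemma selR_posDef {R : Matrix (AllInputs m) (AllInputs m) ℝ} (hR : R.PosDef)
    (S : Finset (Fin q)) : (selR R S).PosDef :=
  hR.submatrix (selIncl_injective S)

lemma dotProduct_selR_mulVec (R : Matrix (AllInputs m) (AllInputs m) ℝ) (S : Finset (Fin q))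
    (x : SelInputs m S → ℝ) : x ⬝ᵥ (selR R S *ᵥ x) =
      (selMatrix m S *ᵥ x) ⬝ᵥ (R *ᵥ (selMatrix m S *ᵥ x)) := by
  rw [selR_eq_mul, dotProduct_transpose_mul_mul_mulVec]

lemma card_selInputs (S : Finset (Fin q)) : Fintype.card (SelInputs m S) = ∑ i ∈ S, m i := by
  rw [Fintype.card_sigma]
  simp only [Fintype.card_fin]
  exact Finset.sum_coe_sort S m

lemma card_allInputs : Fintype.card (AllInputs m) = ∑ i, m i := by
  simp [AllInputs]

end Selection

/-! ### The controllability matrix -/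

section Controllability

variable {n : ℕ} {κ : Type*} [Fintype κ] [DecidableEq κ]

/-- The matrix acts as a sum of `l` blocks `A ^ i * B`, each of norm at most `β ^ (l - 1) * ‖B‖`.
Its purpose is to turn the lower bound `ν` on a singular value into one on `‖B‖`. -/
lemma norm_controllabilityMatrix_le (A : Matrix (Fin n) (Fin n) ℝ) (B : Matrix (Fin n) κ ℝ)
    {l : ℕ} {β : ℝ} (hβ : 1 ≤ β) (hA : ‖A‖ ≤ β) (hn : 0 < n) :
    ‖controllabilityMatrix A B l‖ ≤ l * β ^ (l - 1) * ‖B‖ := by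
  rw [Matrix.l2_opNorm_def]
  refine ContinuousLinearMap.opNorm_le_bound _ (by positivity) fun x => ?_
  have hterm (i : Fin l) : ‖WithLp.toLp 2 ((A ^ (i : ℕ) * B) *ᵥ fun c => x (i, c))‖ ≤
      β ^ (l - 1) * ‖B‖ * ‖x‖ := by
    -- The power bound at `i = 0` uses `‖1‖ = 1`, which fails for `n = 0`.
    have : Nonempty (Fin n) := ⟨⟨0, hn⟩⟩
    have hx : ‖WithLp.toLp 2 (fun c => x (i, c))‖ ≤ ‖x‖ := by
      refine le_of_sq_le_sq ?_ (norm_nonneg _)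
      rw [EuclideanSpace.real_norm_sq_eq, EuclideanSpace.real_norm_sq_eq, Fintype.sum_prod_type]
      exact Finset.single_le_sum (f := fun i => ∑ c, x (i, c) ^ 2)
        (fun _ _ => Finset.sum_nonneg fun _ _ => sq_nonneg _) (Finset.mem_univ i)
    have hpow : ‖A ^ (i : ℕ)‖ ≤ β ^ (l - 1) := by
      have h1 : ‖A ^ (i : ℕ)‖ ≤ ‖A‖ ^ (i : ℕ) := norm_pow_le _ _
      exact (h1.trans (pow_le_pow_left₀ (norm_nonneg _) hA _)).trans
        (pow_le_pow_right₀ hβ (by omega))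
    calc _ ≤ ‖A ^ (i : ℕ) * B‖ * ‖WithLp.toLp 2 (fun c => x (i, c))‖ :=
          Matrix.l2_opNorm_mulVec _ (WithLp.toLp 2 fun c => x (i, c))
      _ ≤ (β ^ (l - 1) * ‖B‖) * ‖x‖ := by
        gcongr
        exact (Matrix.l2_opNorm_mul _ _).trans (by gcongr)
  have e : WithLp.toLp 2 (controllabilityMatrix A B l *ᵥ WithLp.ofLp x) =
      ∑ i : Fin l, WithLp.toLp 2 ((A ^ (i : ℕ) * B) *ᵥ fun c => x (i, c)) := by
    rw [← WithLp.toLp_sum]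
    congr 1
    ext j
    simp [Matrix.mulVec, dotProduct, controllabilityMatrix, Fintype.sum_prod_type,
      Finset.sum_apply]
  calc _ = ‖∑ i : Fin l, WithLp.toLp 2 ((A ^ (i : ℕ) * B) *ᵥ fun c => x (i, c))‖ := by
        rw [← e]; rfl
    _ ≤ ∑ i : Fin l, β ^ (l - 1) * ‖B‖ * ‖x‖ :=
      (norm_sum_le _ _).trans (Finset.sum_le_sum fun i _ => hterm i)
    _ = _ := by simp; ring

end Controllability

/-! ### Square-integrable random vectors -/

section SquareIntegrable

variable {Ω : Type*} [MeasurableSpace Ω] {Pr : Measure Ω}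
  {ι κ : Type*} [Fintype ι] [Fintype κ] [DecidableEq ι] [DecidableEq κ]

/-- A random vector all of whose coordinates are square-integrable. -/
def SquareIntegrable (Pr : Measure Ω) (a : Ω → ι → ℝ) : Prop :=
  ∀ i, MemLp (fun ω => a ω i) 2 Pr

lemma SquareIntegrable.mulVec {a : Ω → κ → ℝ} (ha : SquareIntegrable Pr a) (M : Matrix ι κ ℝ) :
    SquareIntegrable Pr fun ω => M *ᵥ a ω := fun i => by
  simp only [Matrix.mulVec, dotProduct]
  exact memLp_finsetSum _ fun j _ => (ha j).const_mul (M i j)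

lemma SquareIntegrable.add {a b : Ω → ι → ℝ} (ha : SquareIntegrable Pr a)
    (hb : SquareIntegrable Pr b) : SquareIntegrable Pr fun ω => a ω + b ω :=
  fun i => (ha i).add (hb i)

lemma SquareIntegrable.sub {a b : Ω → ι → ℝ} (ha : SquareIntegrable Pr a)
    (hb : SquareIntegrable Pr b) : SquareIntegrable Pr fun ω => a ω - b ω :=
  fun i => (ha i).sub (hb i)

lemma SquareIntegrable.integrable_dotProduct {a b : Ω → ι → ℝ} (ha : SquareIntegrable Pr a)
    (hb : SquareIntegrable Pr b) : Integrable (fun ω => a ω ⬝ᵥ b ω) Pr := by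
  simp only [dotProduct]
  exact integrable_finsetSum _ fun i _ => (ha i).integrable_mul (hb i)

lemma SquareIntegrable.integral_dotProduct_self {a : Ω → ι → ℝ} (ha : SquareIntegrable Pr a) :
    ∫ ω, a ω ⬝ᵥ a ω ∂Pr = ∑ i, ∫ ω, a ω i * a ω i ∂Pr :=
  integral_finsetSum _ fun i _ => (ha i).integrable_mul (ha i)

lemma SquareIntegrable.of_integrable_dotProduct_self {a : Ω → ι → ℝ}
    (hm : ∀ i, AEStronglyMeasurable (fun ω => a ω i) Pr)
    (ha : Integrable (fun ω => a ω ⬝ᵥ a ω) Pr) : SquareIntegrable Pr a := fun i => by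
  rw [memLp_two_iff_integrable_sq (hm i)]
  refine ha.mono' ((hm i).pow 2) (Filter.Eventually.of_forall fun ω => ?_)
  rw [Real.norm_of_nonneg (sq_nonneg _), sq]
  exact Finset.single_le_sum (f := fun j => a ω j * a ω j) (fun _ _ => mul_self_nonneg _)
    (Finset.mem_univ i)

/-- Adding uncorrelated noise with second-moment matrix `W` raises the expectation of a quadratic
form `P` by `Tr (P W)`. -/
lemma integral_quadratic_add_noise {a w : Ω → ι → ℝ} (ha : SquareIntegrable Pr a)
    (hw : SquareIntegrable Pr w) {W : Matrix ι ι ℝ}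
    (hW : ∀ i j, ∫ ω, w ω i * w ω j ∂Pr = W i j)
    (haw : ∀ i j, ∫ ω, a ω i * w ω j ∂Pr = 0) (P : Matrix ι ι ℝ) :
    ∫ ω, (a ω + w ω) ⬝ᵥ (P *ᵥ (a ω + w ω)) ∂Pr =
      ∫ ω, a ω ⬝ᵥ (P *ᵥ a ω) ∂Pr + (P * W).trace := by
  have hform (b c : Ω → ι → ℝ) (hb : SquareIntegrable Pr b) (hc : SquareIntegrable Pr c) :
      ∫ ω, b ω ⬝ᵥ (P *ᵥ c ω) ∂Pr = ∑ i, ∑ j, P i j * ∫ ω, b ω i * c ω j ∂Pr := by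
    simp only [dotProduct, Matrix.mulVec, Finset.mul_sum]
    have e (i j : ι) (ω : Ω) : b ω i * (P i j * c ω j) = P i j * (b ω i * c ω j) := by ring
    simp only [e]
    have hi (i j : ι) : Integrable (fun ω => P i j * (b ω i * c ω j)) Pr :=
      ((hb i).integrable_mul (hc j)).const_mul _
    rw [integral_finsetSum _ fun i _ => integrable_finsetSum _ fun j _ => hi i j]
    refine Finset.sum_congr rfl fun i _ => ?_
    rw [integral_finsetSum _ fun j _ => hi i j]
    simp only [integral_const_mul]
  have i1 := ha.integrable_dotProduct (ha.mulVec P)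
  have i2 := ha.integrable_dotProduct (hw.mulVec P)
  have i3 := hw.integrable_dotProduct (ha.mulVec P)
  have i4 := hw.integrable_dotProduct (hw.mulVec P)
  simp only [Matrix.mulVec_add, dotProduct_add, add_dotProduct]
  have e2 : ∫ ω, a ω ⬝ᵥ (P *ᵥ w ω) ∂Pr = 0 := by
    rw [hform _ _ ha hw]; simp [haw]
  have e3 : ∫ ω, w ω ⬝ᵥ (P *ᵥ a ω) ∂Pr = 0 := by
    rw [hform _ _ hw ha]; simp_rw [mul_comm (w _ _)]; simp [haw]
  have e4 : ∫ ω, w ω ⬝ᵥ (P *ᵥ w ω) ∂Pr = (P * W).trace := by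
    rw [hform _ _ hw hw, Matrix.trace]
    -- The expectation pairs `P i j` with `W i j`, the trace with `W j i`.
    have hsymm (i j : ι) : W i j = W j i := by
      rw [← hW, ← hW]; simp_rw [mul_comm]
    simp only [hW, Matrix.diag, Matrix.mul_apply]
    exact Finset.sum_congr rfl fun i _ => Finset.sum_congr rfl fun j _ => by rw [hsymm]
  have s1 : ∫ ω, (a ω ⬝ᵥ P *ᵥ a ω + w ω ⬝ᵥ P *ᵥ a ω) ∂Pr = ∫ ω, a ω ⬝ᵥ P *ᵥ a ω ∂Pr := by
    rw [integral_add i1 i3, e3, add_zero]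
  have s2 : ∫ ω, (a ω ⬝ᵥ P *ᵥ w ω + w ω ⬝ᵥ P *ᵥ w ω) ∂Pr = (P * W).trace := by
    rw [integral_add i2 i4, e2, e4, zero_add]
  rw [← s1, ← s2]
  exact integral_add (i1.add i3) (i2.add i4)

end SquareIntegrable

/-! ### Causality -/

section Causality

variable {Ω : Type*} [mΩ : MeasurableSpace Ω] {Pr : Measure Ω} {n N : ℕ} {κ : Type*} [Fintype κ]
  [DecidableEq κ] {A : Matrix (Fin n) (Fin n) ℝ} {B : Matrix (Fin n) κ ℝ}
  {W : Matrix (Fin n) (Fin n) ℝ} {w : ℕ → Ω → Fin n → ℝ} {u : ℕ → Ω → κ → ℝ}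

/-- The σ-algebra generated by `w_0, …, w_{k-1}` (and at most by `w_0, …, w_{N-1}`). -/
@[reducible] def noisePast (N : ℕ) (w : ℕ → Ω → Fin n → ℝ) (k : ℕ) : MeasurableSpace Ω :=
  ⨆ j ∈ {j : Fin N | (j : ℕ) < k}, MeasurableSpace.comap (w j) inferInstance

/-- Each input is a measurable function of the states up to the present. -/
def IsCausal (A : Matrix (Fin n) (Fin n) ℝ) (B : Matrix (Fin n) κ ℝ) (w : ℕ → Ω → Fin n → ℝ)
    (N : ℕ) (u : ℕ → Ω → κ → ℝ) : Prop :=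
  ∀ k < N, Measurable[⨆ j : Fin (k + 1),
    MeasurableSpace.comap (stateProcess A B w u j) inferInstance] (u k)

lemma noisePast_mono {j k : ℕ} (h : j ≤ k) : noisePast N w j ≤ noisePast N w k :=
  biSup_mono fun _ hi => lt_of_lt_of_le hi h

lemma measurable_noisePast {j k : ℕ} (hj : j < N) (hk : j < k) :
    Measurable[noisePast N w k] (w j) := by
  have h : MeasurableSpace.comap (w j) inferInstance ≤ noisePast N w k :=
    le_biSup (f := fun i : Fin N => MeasurableSpace.comap (w i) inferInstance)
      (show (⟨j, hj⟩ : Fin N) ∈ {j : Fin N | (j : ℕ) < k} from hk)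
  exact Measurable.mono (comap_measurable (w j)) h le_rfl

lemma IsCausal.measurable_input_of_state (hu : IsCausal A B w N u) {k : ℕ} (hk : k < N)
    (h : ∀ j ≤ k, Measurable[noisePast N w j] (stateProcess A B w u j)) :
    Measurable[noisePast N w k] (u k) := by
  refine Measurable.mono (hu k hk) (iSup_le fun j => ?_) le_rfl
  have hj : (j : ℕ) ≤ k := by omega
  exact (h j hj).comap_le.trans (noisePast_mono hj)

/-- The state `x_k` involves only `w_0, …, w_{k-1}`. The induction is strong because `u_k` may use
all states up to time `k`. -/
lemma IsCausal.measurable_state (hu : IsCausal A B w N u) {k : ℕ} (hk : k ≤ N) :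
    Measurable[noisePast N w k] (stateProcess A B w u k) := by
  induction k using Nat.strong_induction_on with
  | _ k ih =>
    cases k with
    | zero => exact measurable_const
    | succ k =>
      have hx : Measurable[noisePast N w (k + 1)] (stateProcess A B w u k) :=
        (ih k (by omega) (by omega)).mono (noisePast_mono (by omega)) le_rfl
      have hu' : Measurable[noisePast N w (k + 1)] (u k) :=
        (hu.measurable_input_of_state (by omega) fun j hj => ih j (by omega) (by omega)).mono
          (noisePast_mono (by omega)) le_rfl
      have hw' : Measurable[noisePast N w (k + 1)] (w k) := measurable_noisePast hk (by omega)
      have hmA : Measurable fun x : Fin n → ℝ => A *ᵥ x :=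
        (Continuous.matrix_mulVec continuous_const continuous_id).measurable
      have hmB : Measurable fun x : κ → ℝ => B *ᵥ x :=
        (Continuous.matrix_mulVec continuous_const continuous_id).measurable
      exact ((hmA.comp hx).add (hmB.comp hu')).add hw'

lemma IsCausal.measurable_input (hu : IsCausal A B w N u) {k : ℕ} (hk : k < N) :
    Measurable[noisePast N w k] (u k) :=
  hu.measurable_input_of_state hk fun _ hj => hu.measurable_state (by omega)

lemma IsWhiteGaussianNoise.noisePast_le (hw : IsWhiteGaussianNoise Pr N W w) (k : ℕ) :
    noisePast N w k ≤ mΩ :=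
  iSup₂_le fun j _ => (hw.measurable j j.2).comap_le

lemma IsWhiteGaussianNoise.squareIntegrable (hw : IsWhiteGaussianNoise Pr N W w) {k : ℕ}
    (hk : k < N) : SquareIntegrable Pr (w k) := fun i =>
  ((hw.gaussian k hk).eval i).memLp_two

/-- The present noise is uncorrelated with every function of the past noise. -/
lemma IsWhiteGaussianNoise.integral_mul_eq_zero (hw : IsWhiteGaussianNoise Pr N W w) {k : ℕ}
    (hk : k < N) {f : Ω → ℝ} (hf : Measurable[noisePast N w k] f) (i : Fin n) :
    ∫ ω, f ω * w k ω i ∂Pr = 0 := by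
  have hind : Indep (noisePast N w k)
      (⨆ j ∈ ({⟨k, hk⟩} : Set (Fin N)), MeasurableSpace.comap (w j) inferInstance) Pr := by
    refine indep_iSup_of_disjoint (m := fun j : Fin N => MeasurableSpace.comap (w j) inferInstance)
      (fun j => (hw.measurable j j.2).comap_le) hw.indep ?_
    rw [Set.disjoint_singleton_right]
    simp
  rw [iSup_singleton] at hind
  have hwi : Measurable[MeasurableSpace.comap (w k) inferInstance] fun ω => w k ω i :=
    (measurable_pi_apply i).comp (comap_measurable (w k))
  have hfw : IndepFun f (fun ω => w k ω i) Pr :=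
    indep_of_indep_of_le_left (indep_of_indep_of_le_right hind hwi.comap_le) hf.comap_le
  -- The product formula for independent functions needs measurability only, so `f` may be
  -- non-integrable.
  rw [hfw.integral_fun_mul_eq_mul_integral
    (hf.mono (hw.noisePast_le k) le_rfl).aestronglyMeasurable
    ((hw.squareIntegrable hk i).aestronglyMeasurable), hw.mean_zero k hk i, mul_zero]

/-- A process with square-integrable inputs has square-integrable states. -/
lemma stateProcess_squareIntegrable [IsProbabilityMeasure Pr]
    (hw : IsWhiteGaussianNoise Pr N W w) {k : ℕ} (hk : k ≤ N)
    (hu : ∀ j < k, SquareIntegrable Pr (u j)) :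
    SquareIntegrable Pr (stateProcess A B w u k) := by
  induction k with
  | zero => exact fun i => memLp_const 0
  | succ k ih =>
    have hx := ih (by omega) fun j hj => hu j (by omega)
    exact ((hx.mulVec A).add ((hu k (by omega)).mulVec B)).add (hw.squareIntegrable hk)

lemma IsCausal.integral_next_quadratic (hw : IsWhiteGaussianNoise Pr N W w)
    (hu : IsCausal A B w N u) {k : ℕ} (hk : k < N)
    (hx2 : SquareIntegrable Pr (stateProcess A B w u k)) (hu2 : SquareIntegrable Pr (u k))
    (P : Matrix (Fin n) (Fin n) ℝ) :
    ∫ ω, stateProcess A B w u (k + 1) ω ⬝ᵥ (P *ᵥ stateProcess A B w u (k + 1) ω) ∂Pr =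
      ∫ ω, (A *ᵥ stateProcess A B w u k ω + B *ᵥ u k ω) ⬝ᵥ
        (P *ᵥ (A *ᵥ stateProcess A B w u k ω + B *ᵥ u k ω)) ∂Pr + (P * W).trace := by
  refine integral_quadratic_add_noise ((hx2.mulVec A).add (hu2.mulVec B))
    (hw.squareIntegrable hk) (hw.covariance k hk) (fun i j => ?_) P
  refine hw.integral_mul_eq_zero hk (f := fun ω =>
    (A *ᵥ stateProcess A B w u k ω + B *ᵥ u k ω) i) ?_ j
  have hmA : Measurable fun x : Fin n → ℝ => A *ᵥ x :=
    (Continuous.matrix_mulVec continuous_const continuous_id).measurable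
  have hmB : Measurable fun x : κ → ℝ => B *ᵥ x :=
    (Continuous.matrix_mulVec continuous_const continuous_id).measurable
  exact (measurable_pi_apply i).comp
    ((hmA.comp (hu.measurable_state hk.le)).add (hmB.comp (hu.measurable_input hk)))

variable {Q Qf : Matrix (Fin n) (Fin n) ℝ} {R : Matrix κ κ ℝ}

lemma integrable_lqrCost {x : ℕ → Ω → Fin n → ℝ}
    (hx : ∀ k ≤ N, SquareIntegrable Pr (x k)) (hu : ∀ k < N, SquareIntegrable Pr (u k)) :
    Integrable (fun ω => lqrCost Q R Qf N (fun k => x k ω) (fun k => u k ω)) Pr := by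
  refine Integrable.add (integrable_finsetSum _ fun k hk => ?_)
    ((hx N le_rfl).integrable_dotProduct ((hx N le_rfl).mulVec Qf))
  have hk := Finset.mem_range.1 hk
  exact ((hx k hk.le).integrable_dotProduct ((hx k hk.le).mulVec Q)).add
    ((hu k hk).integrable_dotProduct ((hu k hk).mulVec R))

/-- The expected cost of a causal policy exceeds `∑ Tr (P_{k+1} W)` by the expected squared
deviations from the optimal feedback. -/
lemma IsCausal.integral_lqrCost [IsProbabilityMeasure Pr] (hw : IsWhiteGaussianNoise Pr N W w)
    (hu : IsCausal A B w N u) (hu2 : ∀ k < N, SquareIntegrable Pr (u k))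
    (hQ : Q.PosSemidef) (hR : R.PosDef) (hQf : Qf.PosSemidef) :
    ∫ ω, lqrCost Q R Qf N (fun k => stateProcess A B w u k ω) (fun k => u k ω) ∂Pr =
      ∑ k ∈ Finset.range N, (riccatiP A B Q R Qf N (k + 1) * W).trace +
      ∑ k ∈ Finset.range N, ∫ ω,
        (u k ω - riccatiK A B Q R Qf N k *ᵥ stateProcess A B w u k ω) ⬝ᵥ
        ((Bᵀ * riccatiP A B Q R Qf N (k + 1) * B + R) *ᵥ
          (u k ω - riccatiK A B Q R Qf N k *ᵥ stateProcess A B w u k ω)) ∂Pr := by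
  have hx2 (k : ℕ) (hk : k ≤ N) : SquareIntegrable Pr (stateProcess A B w u k) :=
    stateProcess_squareIntegrable hw hk fun j hj => hu2 j (by omega)
  set x := stateProcess A B w u with hx
  set P := riccatiP A B Q R Qf N with hP
  have iQ (k : ℕ) (hk : k < N) : Integrable (fun ω => x k ω ⬝ᵥ (Q *ᵥ x k ω)) Pr :=
    (hx2 k hk.le).integrable_dotProduct ((hx2 k hk.le).mulVec Q)
  have iR (k : ℕ) (hk : k < N) : Integrable (fun ω => u k ω ⬝ᵥ (R *ᵥ u k ω)) Pr :=
    (hu2 k hk).integrable_dotProduct ((hu2 k hk).mulVec R)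
  -- The running cost up to `j` plus the optimal cost-to-go at `x_j` grows at each step by a noise
  -- term and a deviation term. It starts from zero because `x_0 = 0`.
  have key : ∀ j ≤ N, ∑ k ∈ Finset.range j,
      ∫ ω, (x k ω ⬝ᵥ (Q *ᵥ x k ω) + u k ω ⬝ᵥ (R *ᵥ u k ω)) ∂Pr +
        ∫ ω, x j ω ⬝ᵥ (P j *ᵥ x j ω) ∂Pr =
      ∑ k ∈ Finset.range j, (P (k + 1) * W).trace +
      ∑ k ∈ Finset.range j, ∫ ω, (u k ω - riccatiK A B Q R Qf N k *ᵥ x k ω) ⬝ᵥ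
        ((Bᵀ * P (k + 1) * B + R) *ᵥ (u k ω - riccatiK A B Q R Qf N k *ᵥ x k ω)) ∂Pr := by
    intro j hj
    induction j with
    | zero => simp [hx, stateProcess]
    | succ j ih =>
      have ih := ih (by omega)
      rw [Finset.sum_range_succ, Finset.sum_range_succ, Finset.sum_range_succ]
      have hn := hu.integral_next_quadratic hw hj (hx2 j (by omega)) (hu2 j hj) (P (j + 1))
      rw [← hx] at hn
      have hy : SquareIntegrable Pr fun ω => A *ᵥ x j ω + B *ᵥ u j ω :=
        ((hx2 j (by omega)).mulVec A).add ((hu2 j hj).mulVec B)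
      have hd : SquareIntegrable Pr fun ω => u j ω - riccatiK A B Q R Qf N j *ᵥ x j ω :=
        (hu2 j hj).sub ((hx2 j (by omega)).mulVec _)
      have hsq : ∫ ω, (x j ω ⬝ᵥ (Q *ᵥ x j ω) + u j ω ⬝ᵥ (R *ᵥ u j ω)) ∂Pr +
          ∫ ω, (A *ᵥ x j ω + B *ᵥ u j ω) ⬝ᵥ (P (j + 1) *ᵥ (A *ᵥ x j ω + B *ᵥ u j ω)) ∂Pr =
          ∫ ω, x j ω ⬝ᵥ (P j *ᵥ x j ω) ∂Pr +
          ∫ ω, (u j ω - riccatiK A B Q R Qf N j *ᵥ x j ω) ⬝ᵥ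
            ((Bᵀ * P (j + 1) * B + R) *ᵥ (u j ω - riccatiK A B Q R Qf N j *ᵥ x j ω)) ∂Pr := by
        have iQR : Integrable (fun ω => x j ω ⬝ᵥ (Q *ᵥ x j ω) + u j ω ⬝ᵥ (R *ᵥ u j ω)) Pr :=
          (iQ j hj).add (iR j hj)
        rw [← integral_add iQR (hy.integrable_dotProduct (hy.mulVec _)),
          ← integral_add ((hx2 j (by omega)).integrable_dotProduct ((hx2 j (by omega)).mulVec _))
            (hd.integrable_dotProduct (hd.mulVec _))]
        exact integral_congr_ae (Filter.Eventually.of_forall fun ω =>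
          riccatiP_complete_square hQ hR hQf hj (x j ω) (u j ω))
      rw [hn]
      linarith
  rw [← key N le_rfl, hP, riccatiP_self]
  simp only [lqrCost]
  rw [integral_add, integral_finsetSum]
  · exact fun k hk => (iQ k (Finset.mem_range.1 hk)).add (iR k (Finset.mem_range.1 hk))
  · exact integrable_finsetSum _ fun k hk =>
      (iQ k (Finset.mem_range.1 hk)).add (iR k (Finset.mem_range.1 hk))
  · exact (hx2 N le_rfl).integrable_dotProduct ((hx2 N le_rfl).mulVec Qf)

/-- A causal policy with integrable cost has square-integrable inputs. -/
lemma IsCausal.squareIntegrable_input (hw : IsWhiteGaussianNoise Pr N W w)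
    (hu : IsCausal A B w N u) (hQ : Q.PosSemidef) (hQf : Qf.PosSemidef)
    (hR1 : ∀ u, u ⬝ᵥ u ≤ u ⬝ᵥ (R *ᵥ u))
    (hc : Integrable (fun ω => lqrCost Q R Qf N (fun k => stateProcess A B w u k ω)
      (fun k => u k ω)) Pr) {k : ℕ} (hk : k < N) : SquareIntegrable Pr (u k) := by
  have hm : Measurable (u k) := (hu.measurable_input hk).mono (hw.noisePast_le k) le_rfl
  have hmi (i : κ) : Measurable fun ω => u k ω i := (measurable_pi_apply i).comp hm
  refine .of_integrable_dotProduct_self (fun i => (hmi i).aestronglyMeasurable) ?_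
  refine hc.mono' ?_ (Filter.Eventually.of_forall fun ω => ?_)
  · simp only [dotProduct]
    exact (Finset.measurable_sum _ fun i _ => (hmi i).mul (hmi i)).aestronglyMeasurable
  · rw [Real.norm_of_nonneg (dotProduct_self_nonneg_real _)]
    have hnn (j : ℕ) : 0 ≤ stateProcess A B w u j ω ⬝ᵥ (Q *ᵥ stateProcess A B w u j ω) +
        u j ω ⬝ᵥ (R *ᵥ u j ω) :=
      add_nonneg (hQ.nonneg_real _) ((dotProduct_self_nonneg_real _).trans (hR1 _))
    have h1 := Finset.single_le_sum (f := fun j => stateProcess A B w u j ω ⬝ᵥ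
      (Q *ᵥ stateProcess A B w u j ω) + u j ω ⬝ᵥ (R *ᵥ u j ω)) (fun j _ => hnn j)
      (Finset.mem_range.2 hk)
    have h2 := hQf.nonneg_real (stateProcess A B w u N ω)
    have h3 := hQ.nonneg_real (stateProcess A B w u k ω)
    have h4 := hR1 (u k ω)
    simp only [lqrCost] at h1 ⊢
    linarith

end Causality

/-! ### Linear feedback -/

section Feedback

variable {Ω : Type*} [mΩ : MeasurableSpace Ω] {Pr : Measure Ω} [IsProbabilityMeasure Pr] {n N : ℕ}
  {κ : Type*} [Fintype κ]
  [DecidableEq κ] {A : Matrix (Fin n) (Fin n) ℝ} {B : Matrix (Fin n) κ ℝ}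
  {W : Matrix (Fin n) (Fin n) ℝ} {w : ℕ → Ω → Fin n → ℝ} {K : ℕ → Matrix κ (Fin n) ℝ}
  {Q Qf : Matrix (Fin n) (Fin n) ℝ} {R : Matrix κ κ ℝ}

/-- The input process of a linear feedback. -/
def feedbackInput (A : Matrix (Fin n) (Fin n) ℝ) (B : Matrix (Fin n) κ ℝ)
    (K : ℕ → Matrix κ (Fin n) ℝ) (w : ℕ → Ω → Fin n → ℝ) (k : ℕ) (ω : Ω) : κ → ℝ :=
  K k *ᵥ feedbackState A B K w k ω

lemma stateProcess_feedbackInput (k : ℕ) :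
    stateProcess A B w (feedbackInput A B K w) k = feedbackState A B K w k := by
  induction k with
  | zero => rfl
  | succ k ih => simp only [stateProcess, feedbackState, ih, feedbackInput]

lemma isCausal_feedbackInput : IsCausal A B w N (feedbackInput A B K w) := fun k _ => by
  have h : Measurable[⨆ j : Fin (k + 1), MeasurableSpace.comap
      (stateProcess A B w (feedbackInput A B K w) j) inferInstance] (feedbackState A B K w k) := by
    rw [← stateProcess_feedbackInput]
    exact (comap_measurable _).mono (le_iSup (fun j : Fin (k + 1) => MeasurableSpace.comap
      (stateProcess A B w (feedbackInput A B K w) j) inferInstance) (Fin.last k)) le_rfl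
  have hm : Measurable fun x : Fin n → ℝ => K k *ᵥ x :=
    (Continuous.matrix_mulVec continuous_const continuous_id).measurable
  exact hm.comp h

lemma feedbackState_squareIntegrable (hw : IsWhiteGaussianNoise Pr N W w) {k : ℕ} (hk : k ≤ N) :
    SquareIntegrable Pr (feedbackState A B K w k) := by
  induction k with
  | zero => exact fun i => memLp_const 0
  | succ k ih =>
    have hx := ih (by omega)
    exact ((hx.mulVec A).add ((hx.mulVec (K k)).mulVec B)).add (hw.squareIntegrable hk)

lemma feedbackInput_squareIntegrable (hw : IsWhiteGaussianNoise Pr N W w) {k : ℕ} (hk : k < N) :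
    SquareIntegrable Pr (feedbackInput A B K w k) :=
  (feedbackState_squareIntegrable hw hk.le).mulVec (K k)

lemma integrable_feedbackCost (hw : IsWhiteGaussianNoise Pr N W w) :
    Integrable (feedbackCost A B Q R Qf N K w) Pr :=
  integrable_lqrCost (u := feedbackInput A B K w)
    (fun _ hk => feedbackState_squareIntegrable hw hk)
    fun _ hk => feedbackInput_squareIntegrable hw hk

/-- Expected cost of a linear feedback. -/
lemma integral_feedbackCost (hw : IsWhiteGaussianNoise Pr N W w)
    (hQ : Q.PosSemidef) (hR : R.PosDef) (hQf : Qf.PosSemidef) :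
    ∫ ω, feedbackCost A B Q R Qf N K w ω ∂Pr =
      ∑ k ∈ Finset.range N, (riccatiP A B Q R Qf N (k + 1) * W).trace +
      ∑ k ∈ Finset.range N, ∫ ω,
        ((K k - riccatiK A B Q R Qf N k) *ᵥ feedbackState A B K w k ω) ⬝ᵥ
        ((Bᵀ * riccatiP A B Q R Qf N (k + 1) * B + R) *ᵥ
          ((K k - riccatiK A B Q R Qf N k) *ᵥ feedbackState A B K w k ω)) ∂Pr := by
  have h := isCausal_feedbackInput.integral_lqrCost (A := A) (B := B)
    (u := feedbackInput A B K w) hw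
    (fun k hk => feedbackInput_squareIntegrable hw hk) hQ hR hQf
  simp only [stateProcess_feedbackInput] at h
  simp only [Matrix.sub_mulVec]
  exact h

/-- The optimal expected cost is `∑ Tr (P_{k+1} W)`, attained by the Riccati feedback. -/
lemma isLeast_attainableCosts (hw : IsWhiteGaussianNoise Pr N W w)
    (hQ : Q.PosSemidef) (hR : R.PosDef) (hQf : Qf.PosSemidef)
    (hR1 : ∀ u, u ⬝ᵥ u ≤ u ⬝ᵥ (R *ᵥ u)) :
    IsLeast (attainableCosts Pr A B Q R Qf N w)
      (∑ k ∈ Finset.range N, (riccatiP A B Q R Qf N (k + 1) * W).trace) := by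
  constructor
  · refine ⟨feedbackInput A B (riccatiK A B Q R Qf N) w, isCausal_feedbackInput, ?_, ?_⟩
    · simp only [stateProcess_feedbackInput]
      exact integrable_feedbackCost hw
    · simp only [stateProcess_feedbackInput]
      have h := integral_feedbackCost (A := A) (B := B) (K := riccatiK A B Q R Qf N) hw hQ hR hQf
      simp only [sub_self, Matrix.zero_mulVec, zero_dotProduct, integral_zero,
        Finset.sum_const_zero, add_zero] at h
      exact h.symm
  · rintro c ⟨u, hu, hc, rfl⟩
    have hu : IsCausal A B w N u := hu
    -- Integrability of the cost already forces square-integrable inputs because `R ≥ I`, so the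
    -- cost identity applies to every competing policy.
    rw [hu.integral_lqrCost hw (fun k hk => hu.squareIntegrable_input hw hQ hQf hR1 hc hk) hQ hR hQf]
    refine le_add_of_nonneg_right (Finset.sum_nonneg fun k _ => integral_nonneg fun ω => ?_)
    exact (posDef_transpose_mul_mul_add (riccatiP_posSemidef hQ hR hQf N (k + 1))
      hR).posSemidef.nonneg_real _

/-- Second moments of the state under linear feedback. -/
lemma integral_sq_dotProduct_feedbackState (hw : IsWhiteGaussianNoise Pr N W w) {k : ℕ}
    (hk : k ≤ N) (v : Fin n → ℝ) :
    ∫ ω, (v ⬝ᵥ feedbackState A B K w k ω) ^ 2 ∂Pr = ∑ j ∈ Finset.range k,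
      ((transitionMatrix (fun k => A + B * K k) (j + 1) k)ᵀ *ᵥ v) ⬝ᵥ
        (W *ᵥ ((transitionMatrix (fun k => A + B * K k) (j + 1) k)ᵀ *ᵥ v)) := by
  induction k generalizing v with
  | zero => simp [feedbackState]
  | succ k ih =>
    have hx2 := feedbackState_squareIntegrable (A := A) (B := B) (K := K) hw (k := k) (by omega)
    -- The rank-one form `v vᵀ` evaluates to `(v ⬝ᵥ x)²`. One step back replaces `v` by `(A + B
    -- K_k)ᵀ v`, which is why the induction is over all `v`.
    have hn := (isCausal_feedbackInput (A := A) (B := B) (K := K) (N := N) (w := w)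
      ).integral_next_quadratic hw hk (by rwa [stateProcess_feedbackInput])
      (feedbackInput_squareIntegrable hw hk) (Matrix.vecMulVec v v)
    simp only [stateProcess_feedbackInput] at hn
    have e1 (y : Fin n → ℝ) : y ⬝ᵥ (Matrix.vecMulVec v v *ᵥ y) = (v ⬝ᵥ y) ^ 2 := by
      rw [Matrix.vecMulVec_mulVec]
      simp [dotProduct_comm y v, sq]
    have e2 (ω : Ω) : v ⬝ᵥ (A *ᵥ feedbackState A B K w k ω + B *ᵥ feedbackInput A B K w k ω) =
        ((A + B * K k)ᵀ *ᵥ v) ⬝ᵥ feedbackState A B K w k ω := by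
      rw [Matrix.mulVec_transpose, ← Matrix.dotProduct_mulVec, Matrix.add_mulVec,
        ← Matrix.mulVec_mulVec, feedbackInput]
    have e3 : (Matrix.vecMulVec v v * W).trace = v ⬝ᵥ (W *ᵥ v) := by
      rw [Matrix.vecMulVec_mul, Matrix.trace_vecMulVec, Matrix.dotProduct_mulVec, dotProduct_comm]
    simp only [e1, e2, e3] at hn
    rw [hn, ih (by omega), Finset.sum_range_succ, transitionMatrix_self]
    congr 1
    · refine Finset.sum_congr rfl fun j hj => ?_
      have hj := Finset.mem_range.1 hj
      rw [transitionMatrix_succ_right (by omega), Matrix.transpose_mul, Matrix.mulVec_mulVec]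
    · simp

/-- Each past noise contributes at most `‖W‖ ζ² θ^{2 (k-1-j)}`, and the geometric series is summed.
The bound is per direction, so that the number of coordinates is paid for only once, later. -/
lemma integral_sq_dotProduct_feedbackState_le (hw : IsWhiteGaussianNoise Pr N W w) {ζ θ : ℝ}
    (hθ0 : 0 ≤ θ) (hθ1 : θ < 1)
    (hst : ∀ k₁ k₂, k₁ ≤ k₂ → k₂ ≤ N →
      ‖transitionMatrix (fun k => A + B * K k) k₁ k₂‖ ≤ ζ * θ ^ (k₂ - k₁)) {k : ℕ}
    (hk : k ≤ N) (v : Fin n → ℝ) :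
    ∫ ω, (v ⬝ᵥ feedbackState A B K w k ω) ^ 2 ∂Pr ≤
      ‖W‖ * (ζ ^ 2 / (1 - θ ^ 2)) * (v ⬝ᵥ v) := by
  have hv := dotProduct_self_nonneg_real v
  have hθ2 : θ ^ 2 < 1 := by nlinarith
  rw [integral_sq_dotProduct_feedbackState hw hk]
  calc _ ≤ ∑ j ∈ Finset.range k, ‖W‖ * (ζ ^ 2 * (θ ^ 2) ^ (k - 1 - j) * (v ⬝ᵥ v)) := by
        refine Finset.sum_le_sum fun j hj => (dotProduct_mulVec_le _ _).trans ?_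
        have hj := Finset.mem_range.1 hj
        refine mul_le_mul_of_nonneg_left ?_ (norm_nonneg _)
        have h := mulVec_dotProduct_self_le_of_norm_le
          ((norm_transpose_eq _).trans_le (hst (j + 1) k (by omega) hk)) v
        refine h.trans_eq ?_
        rw [show k - 1 - j = k - (j + 1) by omega, mul_pow, ← pow_mul, ← pow_mul, mul_comm 2]
    _ = ‖W‖ * (ζ ^ 2 * (∑ j ∈ Finset.range k, (θ ^ 2) ^ j) * (v ⬝ᵥ v)) := by
        rw [← Finset.sum_range_reflect (fun j => (θ ^ 2) ^ j), Finset.mul_sum, Finset.sum_mul,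
          Finset.mul_sum]
    _ ≤ ‖W‖ * (ζ ^ 2 * (1 - θ ^ 2)⁻¹ * (v ⬝ᵥ v)) := by
        have hs : ∑ j ∈ Finset.range k, (θ ^ 2) ^ j ≤ (1 - θ ^ 2)⁻¹ := by
          rw [← tsum_geometric_of_lt_one (sq_nonneg θ) hθ2]
          exact (summable_geometric_of_lt_one (sq_nonneg θ) hθ2).sum_le_tsum _
            fun _ _ => by positivity
        gcongr
    _ = _ := by rw [div_eq_mul_inv]; ring

/-- Expected squared deviation of two feedbacks, in terms of directional second moments. -/
lemma integral_mulVec_dotProduct_self_le {x : Ω → Fin n → ℝ} (hx : SquareIntegrable Pr x)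
    {s d : ℝ} (hs : 0 ≤ s) (hv : ∀ v, ∫ ω, (v ⬝ᵥ x ω) ^ 2 ∂Pr ≤ s * (v ⬝ᵥ v))
    {D : Matrix κ (Fin n) ℝ} (hD : ‖D‖ ≤ d) :
    ∫ ω, (D *ᵥ x ω) ⬝ᵥ (D *ᵥ x ω) ∂Pr ≤ (min n (Fintype.card κ) : ℕ) * (d ^ 2 * s) := by
  rw [Nat.cast_min, min_mul_of_nonneg _ _ (by positivity), le_min_iff]
  constructor
  -- The factor `n`: extract `‖D‖²` and sum the second moments of `x` over its coordinates.
  · calc ∫ ω, (D *ᵥ x ω) ⬝ᵥ (D *ᵥ x ω) ∂Pr ≤ ∫ ω, d ^ 2 * (x ω ⬝ᵥ x ω) ∂Pr :=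
          integral_mono ((hx.mulVec D).integrable_dotProduct (hx.mulVec D))
            ((hx.integrable_dotProduct hx).const_mul _)
            fun ω => mulVec_dotProduct_self_le_of_norm_le hD (x ω)
      _ = d ^ 2 * ∑ i, ∫ ω, x ω i * x ω i ∂Pr := by
        rw [integral_const_mul, hx.integral_dotProduct_self]
      _ ≤ d ^ 2 * ∑ i : Fin n, s := by
        gcongr with i
        have h := hv (Pi.single i 1)
        simpa [sq] using h
      _ = _ := by simp; ring
  -- The factor `card κ`: coordinate `i` of `D x` is `x` tested in the direction `Dᵀ e_i`, of
  -- squared length at most `d²`.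
  · calc ∫ ω, (D *ᵥ x ω) ⬝ᵥ (D *ᵥ x ω) ∂Pr =
          ∑ i, ∫ ω, (D *ᵥ x ω) i * (D *ᵥ x ω) i ∂Pr :=
          (hx.mulVec D).integral_dotProduct_self
      _ ≤ ∑ i : κ, d ^ 2 * s := by
        refine Finset.sum_le_sum fun i _ => ?_
        have h := hv (Dᵀ *ᵥ Pi.single i 1)
        have h2 := mulVec_dotProduct_self_le_of_norm_le ((norm_transpose_eq D).trans_le hD)
          (Pi.single i 1)
        have h3 : (Pi.single i 1 : κ → ℝ) ⬝ᵥ Pi.single i 1 = 1 := by simp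
        rw [h3, mul_one] at h2
        have e (ω : Ω) : (Dᵀ *ᵥ Pi.single i 1) ⬝ᵥ x ω = (D *ᵥ x ω) i := by
          rw [Matrix.mulVec_transpose, ← Matrix.dotProduct_mulVec]; simp
        simp only [e, sq] at h
        calc _ ≤ s * ((Dᵀ *ᵥ Pi.single i 1) ⬝ᵥ (Dᵀ *ᵥ Pi.single i 1)) := h
          _ ≤ s * d ^ 2 := by gcongr
          _ = _ := by ring
      _ = _ := by simp

end Feedback

/-! ### The constants of the main theorem -/

section Constants

variable {n q T N : ℕ} {m : Fin q → ℕ} {A : Matrix (Fin n) (Fin n) ℝ}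
  {B : Matrix (Fin n) (AllInputs m) ℝ} {Q Qf : Fin T → Matrix (Fin n) (Fin n) ℝ}
  {R : Fin T → Matrix (AllInputs m) (AllInputs m) ℝ} {S : Finset (Fin q)}

lemma le_gammaS (t : Fin T) {k : ℕ} (hk : k < N) :
    max (max ‖A‖ ‖B‖)
      (max ‖riccatiP A (selB B S) (Q t) (selR (R t) S) (Qf t) N (k + 1)‖
        ‖riccatiK A (selB B S) (Q t) (selR (R t) S) (Qf t) N k‖) ≤ gammaS A B Q R Qf N S := by
  unfold gammaS
  refine le_ciSup_of_le (Set.finite_range _).bddAbove t ?_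
  exact le_ciSup_of_le (Set.finite_range _).bddAbove (⟨k, hk⟩ : Fin N) le_rfl

lemma norm_le_sigmaR (t : Fin T) : ‖R t‖ ≤ sigmaR R :=
  le_ciSup (f := fun t => ‖R t‖) (Set.finite_range _).bddAbove t

/-- Only part of `μ_S` is needed: `l ^ (5/2)` is lowered to `l`, the exponent of `β` to `l - 1`, and
the factor `max σ_Q σ_R` to `1`. What remains matches the bound on the controllability matrix. -/
lemma le_muS {l : ℕ} {ν ε : ℝ} (hl : 1 ≤ l) (hν : 0 < ν) (hΓ : 0 ≤ gammaS A B Q R Qf N S)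
    (hσ : 1 ≤ sigmaR R) :
    32 * (l * (max 1 (ε + ‖A‖)) ^ (l - 1)) * (1 + ν⁻¹) * (1 + gammaS A B Q R Qf N S) ^ 3 ≤
      muS A B Q R Qf N S l ν ε := by
  unfold muS
  have hl' : (1 : ℝ) ≤ l := by exact_mod_cast hl
  have h1 : (l : ℝ) ≤ (l : ℝ) ^ (5 / 2 : ℝ) := by
    conv_lhs => rw [← Real.rpow_one (l : ℝ)]
    exact Real.rpow_le_rpow_of_exponent_le hl' (by norm_num)
  have hβ : 1 ≤ max 1 (ε + ‖A‖) := le_max_left _ _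
  have h2 : (max 1 (ε + ‖A‖)) ^ (l - 1) ≤ (max 1 (ε + ‖A‖)) ^ (2 * (l - 1)) :=
    pow_le_pow_right₀ hβ (by omega)
  have h3 : 1 ≤ max (sigmaQ Q Qf) (sigmaR R) := hσ.trans (le_max_right _ _)
  refine le_trans ?_ (le_mul_of_one_le_right (by positivity) h3)
  rw [mul_assoc 32 ((l : ℝ) ^ (5 / 2 : ℝ))]
  gcongr

lemma muS_le_riccatiErrorFactor {l : ℕ} {ν ε : ℝ} (hμ : 0 ≤ muS A B Q R Qf N S l ν ε)
    (hΓ : 0 ≤ gammaS A B Q R Qf N S) (hσ : 1 ≤ sigmaR R) :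
    muS A B Q R Qf N S l ν ε ≤ riccatiErrorFactor A B Q R Qf N S l ν ε := by
  refine le_mul_of_one_le_left hμ (one_le_pow₀ ?_)
  have h1 : 1 ≤ (1 + gammaS A B Q R Qf N S) ^ 9 := one_le_pow₀ (by linarith)
  nlinarith

/-- The smallness condition in the form in which it is used: `b` is the norm of the input matrix
and `D` the amplification of the estimation error. -/
lemma smallness_consequences {b g ζ η ε D c ν : ℝ} (hg : 1 ≤ g) (hζ : 1 ≤ ζ) (hη1 : η < 1)
    (hη0 : 0 < η) (hε : 0 < ε) (hν : 0 < ν) (hc : 1 ≤ c) (hb : 0 ≤ b) (hνb : ν ≤ c * b)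
    (hD : 32 * c * (1 + ν⁻¹) * g ^ 3 ≤ D)
    (hsmall : ε ≤ (1 - η) / (6 * b * ζ) * (g ^ 3)⁻¹ * D⁻¹) :
    32 * g ^ 3 ≤ D ∧ ζ * (b * (3 * g ^ 3 * (D * ε))) ≤ (1 - η) / 2 ∧ 192 * g ^ 6 * ε ≤ 1 := by
  have hν' : 0 < ν⁻¹ := inv_pos.2 hν
  have hb0 : 0 < b := by
    rcases hb.eq_or_lt with h | h
    · rw [← h, mul_zero] at hνb; linarith
    · exact h
  have hg3 : 1 ≤ g ^ 3 := one_le_pow₀ hg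
  have hD1 : 32 * g ^ 3 ≤ D := by
    refine le_trans ?_ hD
    have : 1 ≤ c * (1 + ν⁻¹) := by nlinarith
    calc 32 * g ^ 3 ≤ 32 * g ^ 3 * (c * (1 + ν⁻¹)) := le_mul_of_one_le_right (by positivity) this
      _ = _ := by ring
  have hD0 : 0 < D := by linarith
  have hDb : 32 * g ^ 3 ≤ D * b := by
    -- The factor `ν⁻¹` in `D` makes up for a small `b`, so `D * b` stays large and the bound on `ε`
    -- is not spoiled by the `b` in its denominator.
    have h1 : 1 ≤ c * b * ν⁻¹ := by
      rw [← div_eq_mul_inv, one_le_div hν]; exact hνb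
    calc 32 * g ^ 3 ≤ 32 * g ^ 3 * (c * b * ν⁻¹) := le_mul_of_one_le_right (by positivity) h1
      _ = (32 * c * ν⁻¹ * g ^ 3) * b := by ring
      _ ≤ (32 * c * (1 + ν⁻¹) * g ^ 3) * b := by gcongr; linarith
      _ ≤ D * b := by gcongr
  have hs : ε * (6 * b * ζ * g ^ 3 * D) ≤ 1 - η := by
    have hp : 0 < 6 * b * ζ * g ^ 3 * D := by positivity
    have e : (1 - η) / (6 * b * ζ) * (g ^ 3)⁻¹ * D⁻¹ = (1 - η) / (6 * b * ζ * g ^ 3 * D) := by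
      field_simp
    rw [e] at hsmall
    exact (le_div_iff₀ hp).1 hsmall
  refine ⟨hD1, by linarith, ?_⟩
  calc 192 * g ^ 6 * ε = ε * (6 * g ^ 3 * (32 * g ^ 3)) := by ring
    _ ≤ ε * (6 * g ^ 3 * (D * b)) := by gcongr
    _ ≤ ε * (6 * g ^ 3 * (D * b)) * ζ := le_mul_of_one_le_right (by positivity) hζ
    _ = ε * (6 * b * ζ * g ^ 3 * D) := by ring
    _ ≤ 1 := by linarith

end Constants

theorem proposition2
    {Ω : Type*} [MeasurableSpace Ω] (Pr : Measure Ω) [IsProbabilityMeasure Pr]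
    (n q T N H l : ℕ) (m : Fin q → ℕ)
    (hN : 1 ≤ N) (hH : 1 ≤ H) (hl : 1 ≤ l) (hln : l ≤ n - 1)
    -- true and estimated system matrices
    (A A' : Matrix (Fin n) (Fin n) ℝ) (B B' : Matrix (Fin n) (AllInputs m) ℝ)
    -- cost matrices of the rounds
    (Q Qf : Fin T → Matrix (Fin n) (Fin n) ℝ)
    (R : Fin T → Matrix (AllInputs m) (AllInputs m) ℝ)
    (hQ : ∀ t, (Q t).PosSemidef) (hQf : ∀ t, (Qf t).PosDef) (hR : ∀ t, (R t).PosDef)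
    (hQ1 : ∀ t, 1 ≤ matrixSingularValue n (Q t))
    (hR1 : ∀ t, 1 ≤ matrixSingularValue (∑ i, m i) (R t))
    -- uniform controllability of the systems with `H` actuators
    (ν : ℝ) (hν : 0 < ν)
    (hctrl : ∀ S : Finset (Fin q), S.card = H →
      ν ≤ matrixSingularValue n (controllabilityMatrix A (selB B S) l))
    -- the selected actuators and the round
    (S : Finset (Fin q)) (hS : S.card = H) (t : Fin T)
    -- the noise of the round
    (W : Matrix (Fin n) (Fin n) ℝ) (w : ℕ → Ω → Fin n → ℝ)
    (hw : IsWhiteGaussianNoise Pr N W w)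
    -- the estimation error
    (ε : ℝ) (hε : 0 < ε) (hA : ‖A - A'‖ ≤ ε) (hB : ‖B - B'‖ ≤ ε)
    -- exponential stability constants of the optimal closed loop
    (ζ η : ℝ) (hζ : 1 ≤ ζ) (hη0 : 0 < η) (hη1 : η < 1)
    (hstab : ∀ k₁ k₂ : ℕ, k₁ ≤ k₂ → k₂ ≤ N →
      ‖transitionMatrix (fun k => A + selB B S *
        riccatiK A (selB B S) (Q t) (selR (R t) S) (Qf t) N k) k₁ k₂‖ ≤ ζ * η ^ (k₂ - k₁))
    (hsmall : ε ≤ (1 - η) / (6 * ‖selB B S‖ * ζ) * ((1 + gammaS A B Q R Qf N S) ^ 3)⁻¹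
      * (riccatiErrorFactor A B Q R Qf N S l ν ε)⁻¹) :
    -- the optimal expected cost is `∑ Tr (P_{k+1} W)`, a minimum over causal policies
    IsLeast (attainableCosts Pr A (selB B S) (Q t) (selR (R t) S) (Qf t) N w)
      (∑ k ∈ Finset.range N,
        (riccatiP A (selB B S) (Q t) (selR (R t) S) (Qf t) N (k + 1) * W).trace) ∧
    -- the certainty-equivalent controller has finite expected cost, with the stated excess
    Integrable (feedbackCost A (selB B S) (Q t) (selR (R t) S) (Qf t) N
      (riccatiK A' (selB B' S) (Q t) (selR (R t) S) (Qf t) N) w) Pr ∧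
    (∫ ω, feedbackCost A (selB B S) (Q t) (selR (R t) S) (Qf t) N
        (riccatiK A' (selB B' S) (Q t) (selR (R t) S) (Qf t) N) w ω ∂Pr)
      - ∑ k ∈ Finset.range N,
          (riccatiP A (selB B S) (Q t) (selR (R t) S) (Qf t) N (k + 1) * W).trace
      ≤ 4 * (min n (∑ i ∈ S, m i) : ℕ) * N * ζ ^ 2 / (1 - η ^ 2) * ‖W‖
        * (sigmaR R + gammaS A B Q R Qf N S ^ 3)
        * (3 * (1 + gammaS A B Q R Qf N S) ^ 3 * riccatiErrorFactor A B Q R Qf N S l ν ε) ^ 2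
        * ε ^ 2 := by
  have hl' : (1 : ℝ) ≤ l := by exact_mod_cast hl
  have hQ1' := fun x => dotProduct_self_le_of_one_le_matrixSingularValue (hQ t) (by simp) (hQ1 t) x
  have hR1' (x : SelInputs m S → ℝ) : x ⬝ᵥ x ≤ x ⬝ᵥ (selR (R t) S *ᵥ x) := by
    rw [dotProduct_selR_mulVec, ← selMatrix_mulVec_dotProduct_self]
    exact dotProduct_self_le_of_one_le_matrixSingularValue (hR t).posSemidef card_allInputs.symm
      (hR1 t) _
  have hRS := selR_posDef (hR t) S
  have hQf' := (hQf t).posSemidef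
  have hσR : ‖R t‖ ≤ sigmaR R := norm_le_sigmaR t
  have hσR1 : 1 ≤ sigmaR R := ((hR1 t).trans (matrixSingularValue_le_norm _ _)).trans hσR
  have hmax (k : ℕ) (hk : k < N) := le_gammaS (A := A) (B := B) (Q := Q) (Qf := Qf) (R := R)
    (S := S) t hk
  have hAΓ : ‖A‖ ≤ gammaS A B Q R Qf N S :=
    ((le_max_left _ _).trans (le_max_left _ _)).trans (hmax 0 hN)
  have hBΓ : ‖selB B S‖ ≤ gammaS A B Q R Qf N S :=
    (norm_selB_le B S).trans <| ((le_max_right _ _).trans (le_max_left _ _)).trans (hmax 0 hN)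
  have hPΓ (k : ℕ) (hk1 : 1 ≤ k) (hk : k ≤ N) :
      ‖riccatiP A (selB B S) (Q t) (selR (R t) S) (Qf t) N k‖ ≤ gammaS A B Q R Qf N S := by
    obtain ⟨k, rfl⟩ := Nat.exists_eq_add_of_le' hk1
    exact ((le_max_left _ _).trans (le_max_right _ _)).trans (hmax k hk)
  have hKΓ (k : ℕ) (hk : k < N) :
      ‖riccatiK A (selB B S) (Q t) (selR (R t) S) (Qf t) N k‖ ≤ gammaS A B Q R Qf N S :=
    ((le_max_right _ _).trans (le_max_right _ _)).trans (hmax k hk)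
  have hΓ0 : 0 ≤ gammaS A B Q R Qf N S := (norm_nonneg _).trans hAΓ
  have hβ : 1 ≤ max 1 (ε + ‖A‖) := le_max_left _ _
  have hc : 1 ≤ l * (max 1 (ε + ‖A‖)) ^ (l - 1) := one_le_mul_of_one_le_of_one_le hl'
    (one_le_pow₀ hβ)
  have hνb : ν ≤ l * (max 1 (ε + ‖A‖)) ^ (l - 1) * ‖selB B S‖ :=
    ((hctrl S hS).trans (matrixSingularValue_le_norm _ _)).trans
      (norm_controllabilityMatrix_le A _ hβ (le_max_of_le_right (by linarith)) (by omega))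
  have hμ := le_muS (A := A) (B := B) (Q := Q) (Qf := Qf) (N := N) (S := S) (ε := ε) hl hν hΓ0 hσR1
  have hμ0 : 0 ≤ muS A B Q R Qf N S l ν ε := le_trans (by positivity) hμ
  have hμD := muS_le_riccatiErrorFactor hμ0 hΓ0 hσR1
  obtain ⟨hD, hζd, hε6⟩ := smallness_consequences (by linarith) hζ hη1 hη0 hε hν hc (norm_nonneg _)
    hνb (hμ.trans hμD) hsmall
  set Γ := gammaS A B Q R Qf N S
  set D := riccatiErrorFactor A B Q R Qf N S l ν ε
  have hg1 : 1 ≤ 1 + Γ := by linarith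
  have hg3 : 1 ≤ (1 + Γ) ^ 3 := one_le_pow₀ hg1
  have hε3 : 192 * ((1 + Γ) ^ 3 * ε) ≤ 1 := by
    refine le_trans ?_ hε6
    rw [mul_assoc]
    gcongr
    norm_num
  have hε1 : ε ≤ 1 := by nlinarith
  have hBS : ‖selB B S - selB B' S‖ ≤ ε := by
    rw [selB_sub]; exact (norm_selB_le _ S).trans hB
  -- The Riccati error needs only the factor `6 (1 + Γ)³`, while `D` is at least `32 (1 + Γ)³`.
  have hδ : 6 * (1 + Γ) ^ 3 * ε ≤ D * ε := by gcongr; linarith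
  have hKK (k : ℕ) (hk : k < N) : ‖riccatiK A' (selB B' S) (Q t) (selR (R t) S) (Qf t) N k -
      riccatiK A (selB B S) (Q t) (selR (R t) S) (Qf t) N k‖ ≤ 3 * (1 + Γ) ^ 3 * (D * ε) :=
    norm_lqrGain_sub_le (riccatiP_posSemidef (hQ t) hRS hQf' N (k + 1))
      (riccatiP_posSemidef (hQ t) hRS hQf' N (k + 1)) hRS hR1' hε hε1 hA hBS hAΓ hBΓ
      (hPΓ (k + 1) (by omega) hk) (hKΓ k hk)
      -- The comparison starts at `k₀ = 1`, since `Γ` does not bound `P_0`; the gains involve only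
      -- `P_{k+1}`.
      ((norm_riccatiP_sub_le (hQ t) hRS hQf' hQ1' hR1' hε hA hBS hΓ0 (by linarith) hPΓ
        (Nat.le_add_left 1 k) hk).trans hδ)
      (le_mul_of_one_le_left hε.le (by linarith))
  have hD0 : 0 ≤ D := le_trans (by positivity) hD
  set d := 3 * (1 + Γ) ^ 3 * (D * ε) with hd
  have hd0 : 0 ≤ d := by positivity
  set K := riccatiK A (selB B S) (Q t) (selR (R t) S) (Qf t) N
  set K' := riccatiK A' (selB B' S) (Q t) (selR (R t) S) (Qf t) N
  -- Each closed-loop factor moves by at most `‖B_S‖ d`, and `ζ ‖B_S‖ d ≤ (1 - η) / 2` gives the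
  -- rate `η + (1 - η) / 2`.
  have hst (k₁ k₂ : ℕ) (h1 : k₁ ≤ k₂) (h2 : k₂ ≤ N) :
      ‖transitionMatrix (fun k => A + selB B S * K' k) k₁ k₂‖ ≤
        ζ * ((1 + η) / 2) ^ (k₂ - k₁) := by
    have hpert := norm_transitionMatrix_le_of_perturbation
      (M' := fun k => A + selB B S * K' k) (δ := ‖selB B S‖ * d) (by linarith) hη0.le hstab
      (fun k hk => by
        have e : A + selB B S * K' k - (A + selB B S * K k) = selB B S * (K' k - K k) := by
          rw [Matrix.mul_sub]; abel
        rw [e]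
        exact (Matrix.l2_opNorm_mul _ _).trans (by gcongr; exact hKK k hk)) h1 h2
    refine hpert.trans ?_
    gcongr
    linarith
  have hθ : 0 < 1 - ((1 + η) / 2) ^ 2 :=
    sub_pos.2 (pow_lt_one₀ (by linarith) (by linarith) two_ne_zero)
  refine ⟨isLeast_attainableCosts hw (hQ t) hRS hQf' hR1', integrable_feedbackCost hw, ?_⟩
  rw [integral_feedbackCost hw (hQ t) hRS hQf', add_sub_cancel_left]
  set s := ‖W‖ * (ζ ^ 2 / (1 - ((1 + η) / 2) ^ 2)) with hs
  have hs0 : 0 ≤ s := by positivity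
  have hcM : 0 ≤ sigmaR R + Γ ^ 3 := by positivity
  have hterm (k : ℕ) (hk : k < N) : ∫ ω, ((K' k - K k) *ᵥ feedbackState A (selB B S) K' w k ω) ⬝ᵥ
        (((selB B S)ᵀ * riccatiP A (selB B S) (Q t) (selR (R t) S) (Qf t) N (k + 1) * selB B S +
          selR (R t) S) *ᵥ ((K' k - K k) *ᵥ feedbackState A (selB B S) K' w k ω)) ∂Pr ≤
      (sigmaR R + Γ ^ 3) * ((min n (∑ i ∈ S, m i) : ℕ) * (d ^ 2 * s)) := by
    have hx2 := feedbackState_squareIntegrable (A := A) (B := selB B S) (K := K') hw hk.le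
    have hm := integral_mulVec_dotProduct_self_le hx2 hs0
      (integral_sq_dotProduct_feedbackState_le hw (by linarith) (by linarith) hst hk.le)
      (hKK k hk)
    rw [card_selInputs] at hm
    refine le_trans ?_ (mul_le_mul_of_nonneg_left hm hcM)
    rw [← integral_const_mul]
    refine integral_mono ((hx2.mulVec _).integrable_dotProduct ((hx2.mulVec _).mulVec _))
      (((hx2.mulVec _).integrable_dotProduct (hx2.mulVec _)).const_mul _) fun ω => ?_
    dsimp only
    set y := (K' k - K k) *ᵥ feedbackState A (selB B S) K' w k ω
    have hy := dotProduct_self_nonneg_real y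
    rw [Matrix.add_mulVec, dotProduct_add, dotProduct_transpose_mul_mul_mulVec,
      dotProduct_selR_mulVec, add_mul, add_comm]
    refine add_le_add ?_ ?_
    · refine (dotProduct_mulVec_le _ _).trans ?_
      rw [selMatrix_mulVec_dotProduct_self]
      gcongr
    · calc _ ≤ Γ * ((selB B S *ᵥ y) ⬝ᵥ (selB B S *ᵥ y)) :=
            (dotProduct_mulVec_le _ _).trans (mul_le_mul_of_nonneg_right
              (hPΓ (k + 1) (by omega) hk) (dotProduct_self_nonneg_real _))
        _ ≤ Γ * (Γ ^ 2 * (y ⬝ᵥ y)) := by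
          gcongr
          exact mulVec_dotProduct_self_le_of_norm_le hBΓ y
        _ = _ := by ring
  have hη2 : 0 < 1 - η ^ 2 := sub_pos.2 (pow_lt_one₀ hη0.le hη1 two_ne_zero)
  -- The factor `4` of the final bound pays for the slower rate: `4 - (1 + η)² - (1 - η²) = 2 (1 -
  -- η) ≥ 0`.
  have hrate : ζ ^ 2 / (1 - ((1 + η) / 2) ^ 2) ≤ 4 * ζ ^ 2 / (1 - η ^ 2) := by
    rw [div_le_div_iff₀ hθ hη2]
    have : 1 - η ^ 2 ≤ 4 * (1 - ((1 + η) / 2) ^ 2) := by linarith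
    have := mul_le_mul_of_nonneg_left this (sq_nonneg ζ)
    linarith
  calc _ ≤ ∑ k ∈ Finset.range N,
        (sigmaR R + Γ ^ 3) * ((min n (∑ i ∈ S, m i) : ℕ) * (d ^ 2 * s)) :=
        Finset.sum_le_sum fun k hk => hterm k (Finset.mem_range.1 hk)
    _ = N * ((sigmaR R + Γ ^ 3) * ((min n (∑ i ∈ S, m i) : ℕ) * (d ^ 2 *
        (‖W‖ * (ζ ^ 2 / (1 - ((1 + η) / 2) ^ 2)))))) := by simp [hs]
    _ ≤ N * ((sigmaR R + Γ ^ 3) * ((min n (∑ i ∈ S, m i) : ℕ) * (d ^ 2 *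
        (‖W‖ * (4 * ζ ^ 2 / (1 - η ^ 2)))))) := by gcongr
    _ = _ := by rw [hd]; ring
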